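/- Let $N\ge 1$, let $H\in C^2([0,\infty))$ satisfy $H(\xi)>0$ and $H'(\xi)>0$ for $\xi>0$, $\lim_{\xi\to\infty}H(\xi)=\infty$, and let $H'$ be nondecreasing on some half-line $[R,\infty)$. Let $u_0\ge 0$ be a measurable function on $\mathbb{R}^N$. Notation. Put $\|\varphi\|_{L^1_{\rm ul}}:=\sup_{y\in\mathbb{R}^N}\int_{B(y,1)}|\varphi(x)|\,dx$ and $L^1_{\rm ul}:=\{\varphi\in L^1_{\rm loc}(\mathbb{R}^N):\|\varphi\|_{L^1_{\rm ul}}<\infty\}$; let $\mathcal{L}^1_{\rm ul}$ be the closure in $L^1_{\rm ul}$ of the space of bounded uniformly continuous functions on $\mathbb{R}^N$. Let $[e^{t\Delta}\varphi](x)=\int_{\mathbb{R}^N}(4\pi t)^{-N/2}e^{-|x-y|^2/(4t)}\varphi(y)\,dy$. For $0<\gamma<\min\{2,N\}$, consider $$\partial_t u-\Delta u=|x|^{-\gamma}f(u)\ \text{ in }\mathbb{R}^N\times(0,T),\qquad u(\cdot,0)=u_0. \tag{P}$$ A solution of (P) in $\mathbb{R}^N\times(0,T)$ is a nonnegative measurable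 function $u\in L^\infty((0,T),L^1_{\rm ul})\cap L^\infty_{\rm loc}((0,T),L^\infty(\mathbb{R}^N))$ such that, for every $0<t<T$ and almost every $x\in\mathbb{R}^N$, $$u(x,t)=[e^{t\Delta}u_0](x)+\int_0^t\bigl[e^{(t-s)\Delta}\bigl(|\cdot|^{-\gamma}f(u(\cdot,s))\bigr)\bigr](x)\,ds .$$ For $\theta\in(0,1]$ and $\zeta\ge0$ define, with values in $[0,\infty]$, $$\Phi(\xi):=\sup_{\zeta\le\sigma\le\xi}\frac{H'(\sigma)}{H(\sigma)^{1-\theta}},\qquad \Psi(\xi):=\sup_{\zeta\le\sigma\le\xi}\frac{f(\sigma)}{H(\sigma)^{\theta}},$$ $$Q(\eta):=\Phi(\eta)\int_\eta^\infty\frac{\Psi(\tau)H'(\tau)}{H(\tau)^{1+\frac{2-\gamma}{N}}}\left(1-\left(\frac{H(\eta)}{H(\tau)}\right)^{\frac2N}\right)^{-\frac{\gamma}{2}}d\tau .$$ Statement. There is a constant $C>0$, depending only on $N$, $H$ and $u_0$, with the following property. Let $0<\gamma<\min\{2,N\}$, let $f\in C([0,\infty))$ be nonnegative and nondecreasing on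 $(0,\infty)$, and suppose that there are $\theta\in(0,1]$ and $\zeta\ge0$ such that one of the following holds: (i) $H(u_0)\in L^1_{\rm ul}$ and $\lim_{\eta\to\infty}Q(\eta)=0$; (ii) $H(u_0)\in\mathcal{L}^1_{\rm ul}$ and $\limsup_{\eta\to\infty}Q(\eta)<\infty$. Then there exist $T>0$ and a nonnegative solution $u$ of (P) in $\mathbb{R}^N\times(0,T)$ such that $\|H(u(t))\|_{L^1_{\rm ul}}\le C$ for all $0<t<T$. -/

import Mathlib

open MeasureTheory Set Filter Topology
open scoped ENNReal NNReal

noncomputable section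

namespace HardyParabolic

/-- The Euclidean space `ℝ^N`. -/
abbrev E (N : ℕ) : Type := EuclideanSpace ℝ (Fin N)

/-- The uniformly local norm `sup_y ∫_{B(y,1)} |φ| dx`, with values in `[0,∞]`. -/
def ulNorm {N : ℕ} (φ : E N → ℝ) : ℝ≥0∞ :=
  ⨆ y : E N, ∫⁻ x in Metric.ball y 1, ‖φ x‖ₑ

/-- `φ ∈ L¹_ul(ℝ^N)`. -/
def MemLul {N : ℕ} (φ : E N → ℝ) : Prop :=
  LocallyIntegrable φ volume ∧ ulNorm φ < ⊤

/-- `g ∈ BUC(ℝ^N)`: bounded and uniformly continuous. -/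
def IsBUC {N : ℕ} (g : E N → ℝ) : Prop :=
  UniformContinuous g ∧ ∃ M : ℝ, ∀ x, |g x| ≤ M

/-- `φ` belongs to the closure of `BUC(ℝ^N)` in `L¹_ul(ℝ^N)`. -/
def MemLulClosure {N : ℕ} (φ : E N → ℝ) : Prop :=
  MemLul φ ∧ ∀ ε : ℝ≥0∞, 0 < ε → ∃ g : E N → ℝ, IsBUC g ∧ ulNorm (fun x => φ x - g x) < ε

/-- The Gauss kernel `G(x,t) = (4πt)^{-N/2} exp(-|x|²/(4t))`. -/
def heatKernel {N : ℕ} (x : E N) (t : ℝ) : ℝ :=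
  (4 * Real.pi * t) ^ (-((N : ℝ) / 2)) * Real.exp (-(‖x‖ ^ 2 / (4 * t)))

/-- The heat semigroup `[e^{tΔ} φ](x) = ∫ G(x-y,t) φ(y) dy` on functions with values in
`[0,∞]`, so that the integral is always meaningful. -/
def heatFlow {N : ℕ} (t : ℝ) (φ : E N → ℝ≥0∞) (x : E N) : ℝ≥0∞ :=
  ∫⁻ y, ENNReal.ofReal (heatKernel (x - y) t) * φ y

/-- `u` is a nonnegative solution in `ℝ^N × (0,T)` of `∂ₜu - Δu = |x|^{-γ} f(u)`, `u(·,0) = u₀`.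
All functions in the integral equation are nonnegative, so it is written as an identity in `[0,∞]`;
its left-hand side is finite, hence so are both terms on the right. -/
structure IsSolution {N : ℕ} (γ : ℝ) (f : ℝ → ℝ) (u₀ : E N → ℝ) (T : ℝ) (u : E N → ℝ → ℝ) :
    Prop where
  measurable : Measurable (fun p : E N × Ioo (0 : ℝ) T => u p.1 p.2)
  nonneg : ∀ x, ∀ t ∈ Ioo (0 : ℝ) T, 0 ≤ u x t
  /-- `u ∈ L^∞((0,T), L¹_ul)`. -/
  bounded_ul : ∃ M : ℝ≥0, ∀ᵐ t ∂(volume.restrict (Ioo (0 : ℝ) T)),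
    MemLul (fun x => u x t) ∧ ulNorm (fun x => u x t) ≤ M
  /-- `u ∈ L^∞_loc((0,T), L^∞)`. -/
  locally_bounded : ∀ a b : ℝ, 0 < a → b < T → ∃ M : ℝ≥0,
    ∀ᵐ t ∂(volume.restrict (Icc a b)), eLpNorm (fun x => u x t) ⊤ volume ≤ M
  /-- The integral equation. -/
  mild : ∀ t ∈ Ioo (0 : ℝ) T, ∀ᵐ x : E N,
    ENNReal.ofReal (u x t) =
      heatFlow t (fun y => ENNReal.ofReal (u₀ y)) x +
        ∫⁻ s in Ioo (0 : ℝ) t,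
          heatFlow (t - s) (fun y => ENNReal.ofReal (‖y‖ ^ (-γ) * f (u y s))) x

/-- The derivative of a function on `[0,∞)`, one-sided at `0`. -/
def D (H : ℝ → ℝ) (ξ : ℝ) : ℝ := derivWithin H (Ici 0) ξ

/-- `H ∈ C²([0,∞))`, `H → ∞`, `H > 0` and `H' > 0` on `(0,∞)`, and `H'` is nondecreasing for
large arguments. -/
structure CondH (H : ℝ → ℝ) : Prop where
  contDiff : ContDiffOn ℝ 2 H (Ici 0)
  tendsto : Tendsto H atTop atTop
  pos : ∀ ξ, 0 < ξ → 0 < H ξ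
  deriv_pos : ∀ ξ, 0 < ξ → 0 < D H ξ
  deriv_mono : ∃ R : ℝ, 0 < R ∧ MonotoneOn (D H) (Ici R)

/-- `Φ(ξ) = sup_{ζ ≤ σ ≤ ξ} H'(σ) / H(σ)^{1-θ}`, with values in `[0,∞]`. -/
def Phi (H : ℝ → ℝ) (θ ζ ξ : ℝ) : ℝ≥0∞ :=
  ⨆ σ ∈ Icc ζ ξ, ENNReal.ofReal (D H σ) / ENNReal.ofReal (H σ) ^ (1 - θ)

/-- `Ψ(ξ) = sup_{ζ ≤ σ ≤ ξ} f(σ) / H(σ)^θ`, with values in `[0,∞]`. -/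
def Psi (f H : ℝ → ℝ) (θ ζ ξ : ℝ) : ℝ≥0∞ :=
  ⨆ σ ∈ Icc ζ ξ, ENNReal.ofReal (f σ) / ENNReal.ofReal (H σ) ^ θ

/-- The quantity
`Φ(η) ∫_η^∞ Ψ(τ) H'(τ) / H(τ)^{1+(2-γ)/N} (1 - (H(η)/H(τ))^{2/N})^{-γ/2} dτ` in `[0,∞]`. -/
def quantity (N : ℕ) (γ : ℝ) (f H : ℝ → ℝ) (θ ζ η : ℝ) : ℝ≥0∞ :=
  Phi H θ ζ η *
    ∫⁻ τ in Ioi η, Psi f H θ ζ τ *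
      ENNReal.ofReal (D H τ / H τ ^ (1 + (2 - γ) / (N : ℝ)) *
        (1 - (H η / H τ) ^ (2 / (N : ℝ))) ^ (-(γ / 2)))

end HardyParabolic

end

/-!
Put `w = max u₀ R` and `φ = H(w)`. The function `V = H⁻¹(2 e^{tΔ}φ)` is a supersolution for small
times, so the monotone Picard iteration started at `0` stays below it and converges to a solution
with `H(u) ≤ 2 e^{tΔ}φ`.

On `[R, ∞)` the function `H` is convex. Averaging its tangent line inequality at `p = V(x, t)`
against the heat kernel gives `H'(p) e^{tΔ}w + e^{tΔ}φ ≤ H'(p) p`, so for `V` to be a supersolution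
it suffices that `H'(p)` times the Duhamel term is at most `e^{tΔ}φ`. The Brownian bridge identity
for the heat kernel yields `e^{(t-s)Δ}(|·|^{-γ} e^{sΔ}φ) ≤ C (s(t-s)/t)^{-γ/2} e^{tΔ}φ`. If moreover
`2 e^{sΔ}φ ≤ A s^{-N/2}`, the substitution `H(τ) = A s^{-N/2}` turns the remaining time integral
into the one in `Q(η)`, where `H(η) = A t^{-N/2}`, with the factor `C A^{(2-γ)/N}`. In case (i) `A`
is some large constant and `Q(η) → 0` as `t → 0`; in case (ii) `Q(η)` stays bounded, but `A` can be
taken as small as we please because `φ` is bounded up to an error small in `L¹_ul`.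
-/

noncomputable section

namespace HardyParabolic

variable {N : ℕ}

theorem heatKernel_nonneg (x : E N) {t : ℝ} (ht : 0 < t) : 0 ≤ heatKernel x t := by
  unfold heatKernel; positivity

@[fun_prop]
theorem measurable_heatKernel : Measurable (fun p : E N × ℝ => heatKernel p.1 p.2) := by
  unfold heatKernel
  fun_prop

@[fun_prop]
theorem measurable_ofReal_heatKernel_sub (x : E N) (t : ℝ) :
    Measurable (fun y : E N => ENNReal.ofReal (heatKernel (x - y) t)) :=
  (measurable_heatKernel.comp (f := fun y => (x - y, t)) (by fun_prop)).ennreal_ofReal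

theorem lintegral_exp_neg_mul_norm_sq {b : ℝ} (hb : 0 < b) :
    ∫⁻ y : E N, ENNReal.ofReal (Real.exp (-(b * ‖y‖ ^ 2))) =
      ENNReal.ofReal ((Real.pi / b) ^ ((N : ℝ) / 2)) := by
  have h_integral := GaussianFourier.integral_rexp_neg_mul_sq_norm (V := E N) hb
  simp only [finrank_euclideanSpace, Fintype.card_fin, neg_mul] at h_integral
  have h_integrable : Integrable (fun y : E N => Real.exp (-(b * ‖y‖ ^ 2))) := by
    by_contra h_not
    rw [integral_undef h_not] at h_integral
    have : 0 < (Real.pi / b) ^ ((N : ℝ) / 2) := by positivity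
    exact this.ne h_integral
  rw [← h_integral, ofReal_integral_eq_lintegral_ofReal h_integrable
    (ae_of_all _ fun y => (Real.exp_pos _).le)]

theorem lintegral_heatKernel {t : ℝ} (ht : 0 < t) :
    ∫⁻ y : E N, ENNReal.ofReal (heatKernel y t) = 1 := by
  have hc : 0 ≤ (4 * Real.pi * t) ^ (-((N : ℝ) / 2)) := by positivity
  have h_exponent (y : E N) : ‖y‖ ^ 2 / (4 * t) = 1 / (4 * t) * ‖y‖ ^ 2 := by ring
  simp_rw [heatKernel, ENNReal.ofReal_mul hc, h_exponent]
  rw [lintegral_const_mul _ (by fun_prop), lintegral_exp_neg_mul_norm_sq (by positivity),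
    ← ENNReal.ofReal_mul hc, show Real.pi / (1 / (4 * t)) = 4 * Real.pi * t by field_simp,
    ← Real.rpow_add (by positivity), neg_add_cancel, Real.rpow_zero, ENNReal.ofReal_one]

theorem lintegral_heatKernel_sub {t : ℝ} (ht : 0 < t) (x : E N) :
    ∫⁻ y : E N, ENNReal.ofReal (heatKernel (x - y) t) = 1 := by
  rw [← lintegral_heatKernel (N := N) ht]
  exact lintegral_sub_left_eq_self (fun y : E N => ENNReal.ofReal (heatKernel y t)) x

theorem heatKernel_le (x : E N) {t : ℝ} (ht : 0 < t) :
    heatKernel x t ≤ (4 * Real.pi * t) ^ (-((N : ℝ) / 2)) := by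
  refine mul_le_of_le_one_right (by positivity) (Real.exp_le_one_iff.2 ?_)
  rw [neg_nonpos]
  positivity

/- Both sides are the joint density at `(y, z)` of a Brownian motion from `x` at the times `t - s`
and `t`; on the right it is disintegrated along the endpoint `z`, and the second factor is the
Brownian bridge. -/
theorem heatKernel_mul_heatKernel {s t : ℝ} (hs : 0 < s) (hst : s < t) (x y z : E N) :
    heatKernel (x - y) (t - s) * heatKernel (y - z) s =
      heatKernel ((s / t) • x + ((t - s) / t) • z - y) (s * (t - s) / t) *
        heatKernel (x - z) t := by
  have ht : 0 < t := hs.trans hst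
  have hts : 0 < t - s := sub_pos.2 hst
  have h_exponent : ‖x - y‖ ^ 2 / (4 * (t - s)) + ‖y - z‖ ^ 2 / (4 * s) =
      ‖(s / t) • x + ((t - s) / t) • z - y‖ ^ 2 / (4 * (s * (t - s) / t)) +
        ‖x - z‖ ^ 2 / (4 * t) := by
    simp only [EuclideanSpace.norm_sq_eq, Real.norm_eq_abs, sq_abs, Finset.sum_div,
      ← Finset.sum_add_distrib]
    refine Finset.sum_congr rfl fun i _ => ?_
    simp only [PiLp.sub_apply, PiLp.add_apply, PiLp.smul_apply, smul_eq_mul]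
    field_simp
    ring
  have h_prefactor :
      (4 * Real.pi * (t - s)) ^ (-((N : ℝ) / 2)) * (4 * Real.pi * s) ^ (-((N : ℝ) / 2)) =
        (4 * Real.pi * (s * (t - s) / t)) ^ (-((N : ℝ) / 2)) *
          (4 * Real.pi * t) ^ (-((N : ℝ) / 2)) := by
    rw [← Real.mul_rpow (by positivity) (by positivity),
      ← Real.mul_rpow (by positivity) (by positivity)]
    congr 1
    field_simp
  unfold heatKernel
  rw [mul_mul_mul_comm, h_prefactor, ← Real.exp_add, mul_mul_mul_comm, ← Real.exp_add,
    ← neg_add, ← neg_add, h_exponent]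

theorem measurable_heatFlow {α : Type*} [MeasurableSpace α] {τ : α → ℝ} {x : α → E N}
    {φ : α → E N → ℝ≥0∞} (hτ : Measurable τ) (hx : Measurable x)
    (hφ : Measurable (fun p : α × E N => φ p.1 p.2)) :
    Measurable (fun a => heatFlow (τ a) (φ a) (x a)) :=
  Measurable.lintegral_prod_right' (f := fun p : α × E N =>
    ENNReal.ofReal (heatKernel (x p.1 - p.2) (τ p.1)) * φ p.1 p.2)
    ((measurable_heatKernel.comp (f := fun p : α × E N => (x p.1 - p.2, τ p.1))
      (by fun_prop)).ennreal_ofReal.mul hφ)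

theorem heatFlow_mono {t : ℝ} {φ ψ : E N → ℝ≥0∞} (h : ∀ᵐ y, φ y ≤ ψ y) (x : E N) :
    heatFlow t φ x ≤ heatFlow t ψ x :=
  lintegral_mono_ae (h.mono fun _ hy => by gcongr)

theorem heatFlow_congr {t : ℝ} {φ ψ : E N → ℝ≥0∞} (h : φ =ᵐ[volume] ψ) (x : E N) :
    heatFlow t φ x = heatFlow t ψ x :=
  lintegral_congr_ae (h.mono fun _ hy => by simp only [hy])

theorem heatFlow_const {t : ℝ} (ht : 0 < t) (c : ℝ≥0∞) (x : E N) :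
    heatFlow t (fun _ => c) x = c := by
  rw [heatFlow, lintegral_mul_const _ (by fun_prop), lintegral_heatKernel_sub ht, one_mul]

theorem heatFlow_add (t : ℝ) {φ : E N → ℝ≥0∞} (hφ : AEMeasurable φ) (ψ : E N → ℝ≥0∞)
    (x : E N) : heatFlow t (fun y => φ y + ψ y) x = heatFlow t φ x + heatFlow t ψ x := by
  simp_rw [heatFlow, mul_add]
  exact lintegral_add_left' ((measurable_ofReal_heatKernel_sub x t).aemeasurable.mul hφ) _

theorem heatFlow_const_mul (t : ℝ) (c : ℝ≥0∞) {φ : E N → ℝ≥0∞} (hφ : AEMeasurable φ)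
    (x : E N) : heatFlow t (fun y => c * φ y) x = c * heatFlow t φ x := by
  simp_rw [heatFlow, mul_left_comm _ c]
  exact lintegral_const_mul'' _ ((measurable_ofReal_heatKernel_sub x t).aemeasurable.mul hφ)

theorem heatFlow_weight_mul_heatFlow {s t : ℝ} (hs : 0 < s) (hst : s < t) {ψ φ : E N → ℝ≥0∞}
    (hψ : Measurable ψ) (hφ : Measurable φ) (x : E N) :
    heatFlow (t - s) (fun y => ψ y * heatFlow s φ y) x =
      ∫⁻ z, heatFlow (s * (t - s) / t) ψ ((s / t) • x + ((t - s) / t) • z) *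
        (ENNReal.ofReal (heatKernel (x - z) t) * φ z) := by
  have h_kernel (y z : E N) :
      ENNReal.ofReal (heatKernel (x - y) (t - s)) * ENNReal.ofReal (heatKernel (y - z) s) =
        ENNReal.ofReal (heatKernel ((s / t) • x + ((t - s) / t) • z - y) (s * (t - s) / t)) *
          ENNReal.ofReal (heatKernel (x - z) t) := by
    have h_nonneg := heatKernel_nonneg ((s / t) • x + ((t - s) / t) • z - y)
      (div_pos (mul_pos hs (sub_pos.2 hst)) (hs.trans hst))
    rw [← ENNReal.ofReal_mul (heatKernel_nonneg _ (sub_pos.2 hst)), ← ENNReal.ofReal_mul h_nonneg,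
      heatKernel_mul_heatKernel hs hst]
  have h_meas : Measurable fun p : E N × E N => ENNReal.ofReal (heatKernel (x - p.1) (t - s)) *
      (ψ p.1 * (ENNReal.ofReal (heatKernel (p.1 - p.2) s) * φ p.2)) := by
    have := measurable_heatKernel.comp (f := fun p : E N × E N => (p.1 - p.2, s)) (by fun_prop)
    simp only [Function.comp_def] at this
    fun_prop
  calc heatFlow (t - s) (fun y => ψ y * heatFlow s φ y) x
      = ∫⁻ y, ∫⁻ z, ENNReal.ofReal (heatKernel (x - y) (t - s)) *
          (ψ y * (ENNReal.ofReal (heatKernel (y - z) s) * φ z)) := by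
        refine lintegral_congr fun y => ?_
        simp only [heatFlow]
        rw [← lintegral_const_mul _ (by fun_prop), ← lintegral_const_mul _ (by fun_prop)]
    _ = ∫⁻ z, ∫⁻ y, ENNReal.ofReal (heatKernel (x - y) (t - s)) *
          (ψ y * (ENNReal.ofReal (heatKernel (y - z) s) * φ z)) :=
        lintegral_lintegral_swap h_meas.aemeasurable
    _ = _ := by
        refine lintegral_congr fun z => ?_
        rw [heatFlow, ← lintegral_mul_const _ (by fun_prop)]
        refine lintegral_congr fun y => ?_
        calc ENNReal.ofReal (heatKernel (x - y) (t - s)) *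
              (ψ y * (ENNReal.ofReal (heatKernel (y - z) s) * φ z))
            = ENNReal.ofReal (heatKernel (x - y) (t - s)) * ENNReal.ofReal (heatKernel (y - z) s) *
                (ψ y * φ z) := by ring
          _ = _ := by rw [h_kernel]; ring

theorem heatFlow_weight_mul_heatFlow_le {s t : ℝ} (hs : 0 < s) (hst : s < t) {ψ φ : E N → ℝ≥0∞}
    (hψ : Measurable ψ) (hφ : Measurable φ) {B : ℝ≥0∞}
    (hB : ∀ m, heatFlow (s * (t - s) / t) ψ m ≤ B) (x : E N) :
    heatFlow (t - s) (fun y => ψ y * heatFlow s φ y) x ≤ B * heatFlow t φ x := by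
  rw [heatFlow_weight_mul_heatFlow hs hst hψ hφ, heatFlow, ← lintegral_const_mul _ (by fun_prop)]
  gcongr
  exact hB _

theorem heatFlow_weight_mul_rpow_le (t : ℝ) {ψ φ : E N → ℝ≥0∞} (hψ : Measurable ψ)
    (hφ : Measurable φ) {θ : ℝ} (hθ0 : 0 ≤ θ) (hθ1 : θ ≤ 1) (x : E N) :
    heatFlow t (fun y => ψ y * φ y ^ θ) x ≤
      heatFlow t ψ x ^ (1 - θ) * heatFlow t (fun y => ψ y * φ y) x ^ θ := by
  refine le_trans (le_of_eq ?_) (ENNReal.lintegral_mul_norm_pow_le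
    (f := fun y => ENNReal.ofReal (heatKernel (x - y) t) * ψ y)
    (g := fun y => ENNReal.ofReal (heatKernel (x - y) t) * (ψ y * φ y))
    (Measurable.aemeasurable (by fun_prop)) (Measurable.aemeasurable (by fun_prop))
    (sub_nonneg.2 hθ1) hθ0 (by ring))
  refine lintegral_congr fun y => ?_
  simp only [← mul_assoc]
  rw [ENNReal.mul_rpow_of_nonneg _ (φ y) hθ0, ← mul_assoc,
    ← ENNReal.rpow_add_of_nonneg _ _ (sub_nonneg.2 hθ1) hθ0, sub_add_cancel, ENNReal.rpow_one]

theorem lintegral_comp_smul {F : Type*} [NormedAddCommGroup F] [NormedSpace ℝ F]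
    [MeasurableSpace F] [BorelSpace F] [FiniteDimensional ℝ F] (μ : Measure F)
    [μ.IsAddHaarMeasure] (φ : F → ℝ≥0∞) {r : ℝ} (hr : r ≠ 0) :
    ∫⁻ z, φ (r • z) ∂μ = ENNReal.ofReal |(r ^ Module.finrank ℝ F)⁻¹| * ∫⁻ z, φ z ∂μ := by
  have h_map := lintegral_map_equiv (μ := μ) φ (Homeomorph.smulOfNeZero r hr).toMeasurableEquiv
  simp only [Homeomorph.toMeasurableEquiv_coe, Homeomorph.smulOfNeZero_apply] at h_map
  rw [← h_map, Measure.map_addHaar_smul μ hr, lintegral_smul_measure, smul_eq_mul]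

theorem heatKernel_eq_heatKernel_one (x : E N) {t : ℝ} (ht : 0 < t) :
    heatKernel x t = (√t ^ N)⁻¹ * heatKernel ((√t)⁻¹ • x) 1 := by
  have h_norm : ‖(√t)⁻¹ • x‖ ^ 2 / (4 * 1) = ‖x‖ ^ 2 / (4 * t) := by
    rw [norm_smul, mul_pow, norm_inv, Real.norm_of_nonneg (Real.sqrt_nonneg t), inv_pow,
      Real.sq_sqrt ht.le]
    field_simp
  have h_sqrt : (√t ^ N)⁻¹ = t ^ (-((N : ℝ) / 2)) := by
    rw [Real.sqrt_eq_rpow, ← Real.rpow_natCast, ← Real.rpow_mul ht.le, ← Real.rpow_neg ht.le]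
    congr 2
    ring
  rw [heatKernel, heatKernel, h_norm, h_sqrt, mul_one, Real.mul_rpow (by positivity) ht.le]
  ring

theorem heatFlow_eq_heatFlow_one {t : ℝ} (ht : 0 < t) (φ : E N → ℝ≥0∞) (x : E N) :
    heatFlow t φ x = heatFlow 1 (fun z => φ (√t • z)) ((√t)⁻¹ • x) := by
  have hs : 0 < √t := Real.sqrt_pos.2 ht
  have h_sub (z : E N) : (√t)⁻¹ • x - z = (√t)⁻¹ • (x - √t • z) := by
    rw [smul_sub, inv_smul_smul₀ hs.ne']
  simp_rw [heatFlow, h_sub]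
  rw [lintegral_comp_smul volume
      (fun y => ENNReal.ofReal (heatKernel ((√t)⁻¹ • (x - y)) 1) * φ y) hs.ne',
    finrank_euclideanSpace, Fintype.card_fin, abs_of_pos (by positivity),
    ← lintegral_const_mul' _ _ ENNReal.ofReal_ne_top]
  refine lintegral_congr fun y => ?_
  rw [← mul_assoc, ← ENNReal.ofReal_mul (by positivity), ← heatKernel_eq_heatKernel_one _ ht]

/-- The potential `|y|^{-γ}` of the equation, as a weight with values in `[0,∞]`. -/
def hardyWeight (γ : ℝ) (y : E N) : ℝ≥0∞ := ENNReal.ofReal (‖y‖ ^ (-γ))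

@[fun_prop]
theorem measurable_hardyWeight (γ : ℝ) : Measurable (hardyWeight (N := N) γ) := by
  unfold hardyWeight
  fun_prop

theorem hardyWeight_smul (γ : ℝ) {r : ℝ} (hr : 0 ≤ r) (y : E N) :
    hardyWeight γ (r • y) = ENNReal.ofReal (r ^ (-γ)) * hardyWeight γ y := by
  rw [hardyWeight, norm_smul, Real.norm_of_nonneg hr, Real.mul_rpow hr (norm_nonneg y),
    ENNReal.ofReal_mul (by positivity), hardyWeight]

/-- An upper bound for `e^{Δ} |·|^{-γ}` on `ℝ^N`: the singularity is integrated against the maximum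
of the kernel, and outside the unit ball the weight is at most `1`. -/
def hardyConst (N : ℕ) (γ : ℝ) : ℝ≥0∞ :=
  ENNReal.ofReal ((4 * Real.pi * 1) ^ (-((N : ℝ) / 2))) *
    (∫⁻ y in Metric.ball (0 : E N) 1, hardyWeight γ y) + 1

theorem hardyConst_ne_top {γ : ℝ} (hγ0 : 0 ≤ γ) (hγ : γ < N) : hardyConst N γ ≠ ⊤ := by
  have h_integrable : IntegrableOn (fun y : E N => ‖y‖ ^ (-γ)) (Metric.ball 0 1) := by
    have hN : 0 < N := by exact_mod_cast hγ0.trans_lt hγ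
    refine integrableOn_ball_of_norm_le_rpow (C := 1) (α := γ) (by simpa using Nat.succ_le_of_lt hN)
      (by simpa using hγ) (ae_of_all _ fun x => ?_) (Measurable.aestronglyMeasurable (by fun_prop))
    rw [one_mul, Real.norm_of_nonneg (by positivity)]
  have h_finite := (hasFiniteIntegral_iff_ofReal (ae_of_all _ fun y => by positivity)).1
    h_integrable.2
  exact ENNReal.add_ne_top.2 ⟨ENNReal.mul_ne_top ENNReal.ofReal_ne_top h_finite.ne,
    ENNReal.one_ne_top⟩

theorem heatFlow_one_hardyWeight_le {γ : ℝ} (hγ : 0 ≤ γ) (x : E N) :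
    heatFlow 1 (hardyWeight γ) x ≤ hardyConst N γ := by
  have h_split (y : E N) :
      hardyWeight γ y ≤ (Metric.ball 0 1).indicator (hardyWeight γ) y + 1 := by
    by_cases hy : y ∈ Metric.ball (0 : E N) 1
    · rw [indicator_of_mem hy]
      exact le_self_add
    · rw [indicator_of_notMem hy, zero_add]
      have hy1 : 1 ≤ ‖y‖ := by simpa using hy
      exact ENNReal.ofReal_le_one.2 (Real.rpow_le_one_of_one_le_of_nonpos hy1 (by linarith))
  have h_meas : Measurable ((Metric.ball (0 : E N) 1).indicator (hardyWeight γ)) :=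
    (measurable_hardyWeight γ).indicator measurableSet_ball
  calc heatFlow 1 (hardyWeight γ) x
      ≤ heatFlow 1 (fun y => (Metric.ball 0 1).indicator (hardyWeight γ) y + 1) x :=
        heatFlow_mono (ae_of_all _ h_split) x
    _ = heatFlow 1 ((Metric.ball 0 1).indicator (hardyWeight γ)) x + 1 := by
        rw [heatFlow_add 1 h_meas.aemeasurable, heatFlow_const one_pos]
    _ ≤ hardyConst N γ := by
        rw [hardyConst, ← lintegral_indicator measurableSet_ball,
          ← lintegral_const_mul _ h_meas, heatFlow]
        gcongr
        exact heatKernel_le _ one_pos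

theorem heatFlow_hardyWeight_le {γ : ℝ} (hγ : 0 ≤ γ) {t : ℝ} (ht : 0 < t) (x : E N) :
    heatFlow t (hardyWeight γ) x ≤ hardyConst N γ * ENNReal.ofReal (t ^ (-(γ / 2))) := by
  have h_sqrt : √t ^ (-γ) = t ^ (-(γ / 2)) := by
    rw [Real.sqrt_eq_rpow, ← Real.rpow_mul ht.le]
    congr 1
    ring
  simp_rw [heatFlow_eq_heatFlow_one ht (hardyWeight γ), hardyWeight_smul γ (Real.sqrt_nonneg t)]
  rw [heatFlow_const_mul _ _ (by fun_prop), h_sqrt, mul_comm]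
  gcongr
  exact heatFlow_one_hardyWeight_le hγ _

/-- The uniformly local norm of a `[0,∞]`-valued function. -/
def ulMass (φ : E N → ℝ≥0∞) : ℝ≥0∞ :=
  ⨆ y : E N, ∫⁻ x in Metric.ball y 1, φ x

theorem setLIntegral_ball_le_ulMass (φ : E N → ℝ≥0∞) (y : E N) :
    ∫⁻ x in Metric.ball y 1, φ x ≤ ulMass φ :=
  le_iSup (fun y => ∫⁻ x in Metric.ball y 1, φ x) y

theorem ulMass_mono {φ ψ : E N → ℝ≥0∞} (h : ∀ᵐ x, φ x ≤ ψ x) : ulMass φ ≤ ulMass ψ :=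
  iSup_mono fun _ => lintegral_mono_ae (ae_restrict_of_ae h)

theorem ulMass_add_const_le (φ : E N → ℝ≥0∞) (c : ℝ≥0∞) :
    ulMass (fun x => φ x + c) ≤ ulMass φ + c * volume (Metric.ball (0 : E N) 1) := by
  refine iSup_le fun y => ?_
  rw [lintegral_add_right _ measurable_const, setLIntegral_const, Measure.addHaar_ball_center]
  gcongr
  exact setLIntegral_ball_le_ulMass φ y

theorem ulMass_const_mul {c : ℝ≥0∞} (hc : c ≠ ⊤) (φ : E N → ℝ≥0∞) :
    ulMass (fun x => c * φ x) = c * ulMass φ := by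
  simp_rw [ulMass, lintegral_const_mul' _ _ hc, ENNReal.mul_iSup]

theorem lintegral_setLIntegral_ball_mul {X : Type*} [PseudoMetricSpace X]
    [SecondCountableTopology X] [MeasurableSpace X] [OpensMeasurableSpace X] (μ : Measure X)
    [SFinite μ] {f φ : X → ℝ≥0∞} (hf : Measurable f) (hφ : AEMeasurable φ μ) (r : ℝ) :
    ∫⁻ y, (∫⁻ z in Metric.ball y r, f z ∂μ) * φ y ∂μ =
      ∫⁻ z, f z * ∫⁻ y in Metric.ball z r, φ y ∂μ ∂μ := by
  let near : Set (X × X) := {p | dist p.1 p.2 < r}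
  have h_near : MeasurableSet near := measurableSet_lt (by fun_prop) (by fun_prop)
  calc ∫⁻ y, (∫⁻ z in Metric.ball y r, f z ∂μ) * φ y ∂μ
      = ∫⁻ y, ∫⁻ z, near.indicator (fun p => f p.2 * φ p.1) (y, z) ∂μ ∂μ := by
        refine lintegral_congr fun y => ?_
        rw [← lintegral_mul_const _ hf, ← lintegral_indicator Metric.isOpen_ball.measurableSet]
        refine lintegral_congr fun z => ?_
        simp only [near, indicator, Metric.mem_ball, mem_ofPred_eq, dist_comm]
    _ = ∫⁻ z, ∫⁻ y, near.indicator (fun p => f p.2 * φ p.1) (y, z) ∂μ ∂μ :=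
        lintegral_lintegral_swap
          (((hf.comp measurable_snd).aemeasurable.mul hφ.comp_fst).indicator h_near)
    _ = ∫⁻ z, f z * ∫⁻ y in Metric.ball z r, φ y ∂μ ∂μ := by
        refine lintegral_congr fun z => ?_
        rw [← lintegral_const_mul'' _ hφ.restrict,
          ← lintegral_indicator Metric.isOpen_ball.measurableSet]
        rfl

theorem heatKernel_one_le {x y : E N} (h : ‖x - y‖ ≤ 1) :
    heatKernel x 1 ≤ 2 ^ ((N : ℝ) / 2) * Real.exp (1 / 4) * heatKernel y 2 := by
  have h_exp : Real.exp (-(‖x‖ ^ 2 / (4 * 1))) ≤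
      Real.exp (1 / 4) * Real.exp (-(‖y‖ ^ 2 / (4 * 2))) := by
    rw [← Real.exp_add, Real.exp_le_exp]
    have h_norm : ‖y‖ ≤ ‖x‖ + 1 := by
      linarith [norm_le_norm_add_norm_sub x y]
    nlinarith [sq_nonneg (‖x‖ - 1), norm_nonneg y]
  have h_prefactor : (4 * Real.pi * 1) ^ (-((N : ℝ) / 2)) =
      2 ^ ((N : ℝ) / 2) * (4 * Real.pi * 2) ^ (-((N : ℝ) / 2)) := by
    rw [Real.mul_rpow (by positivity) zero_le_two, mul_one, mul_left_comm,
      ← Real.rpow_add zero_lt_two, add_neg_cancel, Real.rpow_zero, mul_one]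
  calc heatKernel x 1
      ≤ (4 * Real.pi * 1) ^ (-((N : ℝ) / 2)) *
          (Real.exp (1 / 4) * Real.exp (-(‖y‖ ^ 2 / (4 * 2)))) := by
        unfold heatKernel
        gcongr
    _ = 2 ^ ((N : ℝ) / 2) * Real.exp (1 / 4) * heatKernel y 2 := by
        rw [h_prefactor, heatKernel]
        ring

theorem heatKernel_le_rpow_mul_heatKernel_one (x : E N) {t : ℝ} (ht0 : 0 < t) (ht1 : t ≤ 1) :
    heatKernel x t ≤ t ^ (-((N : ℝ) / 2)) * heatKernel x 1 := by
  unfold heatKernel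
  rw [mul_one, Real.mul_rpow (by positivity) ht0.le, ← mul_assoc,
    mul_comm (t ^ (-((N : ℝ) / 2)))]
  gcongr

/-- The constant of the estimate `‖e^Δ φ‖_∞ ≤ C ‖φ‖_{L¹_ul}`. -/
def smoothingConst (N : ℕ) : ℝ≥0∞ :=
  ENNReal.ofReal (2 ^ ((N : ℝ) / 2) * Real.exp (1 / 4)) / volume (Metric.ball (0 : E N) 1)

theorem smoothingConst_ne_top (N : ℕ) : smoothingConst N ≠ ⊤ :=
  ENNReal.div_ne_top ENNReal.ofReal_ne_top (Metric.measure_ball_pos _ _ one_pos).ne'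

theorem ofReal_heatKernel_one_le (x y : E N) :
    ENNReal.ofReal (heatKernel (x - y) 1) ≤
      smoothingConst N * ∫⁻ z in Metric.ball y 1, ENNReal.ofReal (heatKernel (x - z) 2) := by
  set V := volume (Metric.ball (0 : E N) 1)
  set c := ENNReal.ofReal (2 ^ ((N : ℝ) / 2) * Real.exp (1 / 4))
  have hV0 : V ≠ 0 := (Metric.measure_ball_pos _ _ one_pos).ne'
  have hV : V ≠ ⊤ := measure_ball_lt_top.ne
  have h_center : V = volume (Metric.ball y 1) := (Measure.addHaar_ball_center volume y 1).symm
  have h_average : ENNReal.ofReal (heatKernel (x - y) 1) * V ≤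
      c * ∫⁻ z in Metric.ball y 1, ENNReal.ofReal (heatKernel (x - z) 2) := by
    rw [h_center, ← setLIntegral_const,
      ← lintegral_const_mul _ (by fun_prop)]
    refine setLIntegral_mono (by fun_prop) fun z hz => ?_
    rw [← ENNReal.ofReal_mul (by positivity)]
    refine ENNReal.ofReal_le_ofReal (heatKernel_one_le ?_)
    rw [sub_sub_sub_cancel_left, ← dist_eq_norm]
    exact (Metric.mem_ball.1 hz).le
  calc ENNReal.ofReal (heatKernel (x - y) 1)
      ≤ (c * ∫⁻ z in Metric.ball y 1, ENNReal.ofReal (heatKernel (x - z) 2)) / V :=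
        (ENNReal.le_div_iff_mul_le (Or.inl hV0) (Or.inl hV)).2 h_average
    _ = smoothingConst N * ∫⁻ z in Metric.ball y 1, ENNReal.ofReal (heatKernel (x - z) 2) :=
        ENNReal.mul_div_right_comm

theorem heatFlow_one_le {φ : E N → ℝ≥0∞} (hφ : AEMeasurable φ) (x : E N) :
    heatFlow 1 φ x ≤ smoothingConst N * ulMass φ := by
  calc heatFlow 1 φ x
      ≤ ∫⁻ y, smoothingConst N *
          ((∫⁻ z in Metric.ball y 1, ENNReal.ofReal (heatKernel (x - z) 2)) * φ y) := by
        refine lintegral_mono fun y => ?_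
        rw [← mul_assoc]
        gcongr
        exact ofReal_heatKernel_one_le x y
    _ = smoothingConst N *
          ∫⁻ z, ENNReal.ofReal (heatKernel (x - z) 2) * ∫⁻ y in Metric.ball z 1, φ y := by
        rw [lintegral_const_mul' _ _ (smoothingConst_ne_top N),
          lintegral_setLIntegral_ball_mul volume (by fun_prop) hφ]
    _ ≤ smoothingConst N * ∫⁻ z, ENNReal.ofReal (heatKernel (x - z) 2) * ulMass φ := by
        gcongr
        exact setLIntegral_ball_le_ulMass φ _
    _ = smoothingConst N * ulMass φ := by
        rw [lintegral_mul_const _ (by fun_prop), lintegral_heatKernel_sub zero_lt_two, one_mul]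

theorem heatFlow_le_rpow_mul_ulMass {φ : E N → ℝ≥0∞} (hφ : AEMeasurable φ) {t : ℝ} (ht0 : 0 < t)
    (ht1 : t ≤ 1) (x : E N) :
    heatFlow t φ x ≤ ENNReal.ofReal (t ^ (-((N : ℝ) / 2))) * (smoothingConst N * ulMass φ) := by
  calc heatFlow t φ x
      ≤ ∫⁻ y, ENNReal.ofReal (t ^ (-((N : ℝ) / 2))) *
          (ENNReal.ofReal (heatKernel (x - y) 1) * φ y) := by
        refine lintegral_mono fun y => ?_
        rw [← mul_assoc, ← ENNReal.ofReal_mul (by positivity)]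
        gcongr
        exact heatKernel_le_rpow_mul_heatKernel_one _ ht0 ht1
    _ = ENNReal.ofReal (t ^ (-((N : ℝ) / 2))) * heatFlow 1 φ x :=
        lintegral_const_mul' _ _ ENNReal.ofReal_ne_top
    _ ≤ _ := by
        gcongr
        exact heatFlow_one_le hφ x

theorem heatFlow_eq_lintegral_sub (t : ℝ) (φ : E N → ℝ≥0∞) (x : E N) :
    heatFlow t φ x = ∫⁻ w, ENNReal.ofReal (heatKernel w t) * φ (x - w) := by
  rw [← lintegral_sub_left_eq_self _ x]
  simp only [sub_sub_cancel, heatFlow]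

theorem setLIntegral_ball_comp_sub (φ : E N → ℝ≥0∞) (y w : E N) :
    ∫⁻ x in Metric.ball y 1, φ (x - w) = ∫⁻ x in Metric.ball (y - w) 1, φ x := by
  rw [← lintegral_indicator measurableSet_ball, ← lintegral_indicator measurableSet_ball,
    ← lintegral_sub_right_eq_self ((Metric.ball (y - w) 1).indicator φ) w]
  refine lintegral_congr fun x => ?_
  simp only [indicator, Metric.mem_ball, dist_sub_right]

theorem ulMass_heatFlow_le {φ : E N → ℝ≥0∞} (hφ : Measurable φ) {t : ℝ} (ht : 0 < t) :
    ulMass (heatFlow t φ) ≤ ulMass φ := by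
  have h_kernel : Measurable fun w : E N => ENNReal.ofReal (heatKernel w t) :=
    (measurable_heatKernel.comp (f := fun w => (w, t)) (by fun_prop)).ennreal_ofReal
  refine iSup_le fun y => ?_
  calc ∫⁻ x in Metric.ball y 1, heatFlow t φ x
      = ∫⁻ w, ∫⁻ x in Metric.ball y 1, ENNReal.ofReal (heatKernel w t) * φ (x - w) := by
        simp_rw [heatFlow_eq_lintegral_sub]
        exact lintegral_lintegral_swap (Measurable.aemeasurable
          ((h_kernel.comp measurable_snd).mul (hφ.comp (measurable_fst.sub measurable_snd))))
    _ ≤ ∫⁻ w, ENNReal.ofReal (heatKernel w t) * ulMass φ := by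
        refine lintegral_mono fun w => ?_
        rw [lintegral_const_mul _ (by fun_prop), setLIntegral_ball_comp_sub]
        gcongr
        exact setLIntegral_ball_le_ulMass φ _
    _ = ulMass φ := by
        rw [lintegral_mul_const _ h_kernel, lintegral_heatKernel ht, one_mul]

theorem map_iSup_of_lowerSemicontinuous {G : ℝ≥0∞ → ℝ≥0∞} (hG : Monotone G)
    (hG_lsc : LowerSemicontinuous G) {a : ℕ → ℝ≥0∞} (ha : Monotone a) :
    G (⨆ n, a n) = ⨆ n, G (a n) := by
  refine le_antisymm (le_of_forall_lt fun c hc => ?_) hG.le_map_iSup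
  obtain ⟨n, hn⟩ := ((tendsto_atTop_iSup ha).eventually (hG_lsc _ c hc)).exists
  exact hn.trans_le (le_iSup (fun n => G (a n)) n)

/-- The right-hand side `e^{tΔ} w + ∫₀ᵗ e^{(t-s)Δ} (ψ G(U(s))) ds` of the integral equation, as an
operator on `[0,∞]`-valued functions. -/
def duhamel (ψ : E N → ℝ≥0∞) (G : ℝ≥0∞ → ℝ≥0∞) (w : E N → ℝ≥0∞) (U : E N → ℝ → ℝ≥0∞)
    (x : E N) (t : ℝ) : ℝ≥0∞ :=
  heatFlow t w x + ∫⁻ s in Ioo 0 t, heatFlow (t - s) (fun y => ψ y * G (U y s)) x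

theorem duhamel_le_duhamel {ψ : E N → ℝ≥0∞} {G : ℝ≥0∞ → ℝ≥0∞} (hG : Monotone G)
    (w : E N → ℝ≥0∞) {U V : E N → ℝ → ℝ≥0∞} {t : ℝ} (h : ∀ s ∈ Ioo 0 t, ∀ y, U y s ≤ V y s)
    (x : E N) : duhamel ψ G w U x t ≤ duhamel ψ G w V x t := by
  refine add_le_add_right (setLIntegral_mono' measurableSet_Ioo fun s hs => ?_) _
  exact heatFlow_mono (ae_of_all _ fun y => mul_le_mul_right (hG (h s hs y)) _) x

theorem monotone_duhamel (ψ : E N → ℝ≥0∞) {G : ℝ≥0∞ → ℝ≥0∞} (hG : Monotone G)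
    (w : E N → ℝ≥0∞) : Monotone (duhamel ψ G w) :=
  fun _ _ h x _ => duhamel_le_duhamel hG w (fun s _ y => h y s) x

theorem measurable_heatFlow_source {ψ : E N → ℝ≥0∞} (hψ : Measurable ψ) {G : ℝ≥0∞ → ℝ≥0∞}
    (hG : Measurable G) {U : E N → ℝ → ℝ≥0∞} (hU : Measurable (fun p : E N × ℝ => U p.1 p.2)) :
    Measurable (fun q : (E N × ℝ) × ℝ =>
      heatFlow (q.1.2 - q.2) (fun y => ψ y * G (U y q.2)) q.1.1) := by
  have hGU := hG.comp
    (hU.comp (f := fun p : ((E N × ℝ) × ℝ) × E N => (p.2, p.1.2)) (by fun_prop))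
  exact measurable_heatFlow (τ := fun q : (E N × ℝ) × ℝ => q.1.2 - q.2) (x := fun q => q.1.1)
    (φ := fun q y => ψ y * G (U y q.2)) (by fun_prop) (by fun_prop)
    ((hψ.comp measurable_snd).mul hGU)

theorem measurable_duhamel {ψ : E N → ℝ≥0∞} (hψ : Measurable ψ) {G : ℝ≥0∞ → ℝ≥0∞}
    (hG : Measurable G) {w : E N → ℝ≥0∞} (hw : Measurable w) {U : E N → ℝ → ℝ≥0∞}
    (hU : Measurable (fun p : E N × ℝ => U p.1 p.2)) :
    Measurable (fun p : E N × ℝ => duhamel ψ G w U p.1 p.2) := by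
  have h_indicator (p : E N × ℝ) :
      ∫⁻ s in Ioo 0 p.2, heatFlow (p.2 - s) (fun y => ψ y * G (U y s)) p.1 =
        ∫⁻ s, {q : (E N × ℝ) × ℝ | 0 < q.2 ∧ q.2 < q.1.2}.indicator
          (fun q => heatFlow (q.1.2 - q.2) (fun y => ψ y * G (U y q.2)) q.1.1) (p, s) := by
    rw [← lintegral_indicator measurableSet_Ioo]
    rfl
  simp_rw [duhamel, h_indicator]
  refine (measurable_heatFlow (τ := fun p : E N × ℝ => p.2) (x := fun p => p.1) (φ := fun _ => w)
    measurable_snd measurable_fst (hw.comp measurable_snd)).add ?_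
  exact ((measurable_heatFlow_source hψ hG hU).indicator
    ((measurableSet_lt measurable_const measurable_snd).inter
      (measurableSet_lt measurable_snd measurable_fst.snd))).lintegral_prod_right'

theorem duhamel_iSup {ψ : E N → ℝ≥0∞} (hψ : Measurable ψ) {G : ℝ≥0∞ → ℝ≥0∞} (hG : Monotone G)
    (hG_lsc : LowerSemicontinuous G) (w : E N → ℝ≥0∞) {U : ℕ → E N → ℝ → ℝ≥0∞}
    (hU : ∀ n, Measurable (fun p : E N × ℝ => U n p.1 p.2)) (hU_mono : Monotone U)
    (x : E N) (t : ℝ) :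
    duhamel ψ G w (fun y s => ⨆ n, U n y s) x t = ⨆ n, duhamel ψ G w (U n) x t := by
  have h_source_mono (s : ℝ) : Monotone fun n y => ψ y * G (U n y s) :=
    fun m n hmn y => mul_le_mul_right (hG (hU_mono hmn y s)) _
  have h_source (s : ℝ) (y : E N) :
      ψ y * G (⨆ n, U n y s) = ⨆ n, ψ y * G (U n y s) := by
    rw [map_iSup_of_lowerSemicontinuous hG hG_lsc fun m n hmn => hU_mono hmn y s, ENNReal.mul_iSup]
  have h_heatFlow (s : ℝ) : heatFlow (t - s) (fun y => ψ y * G (⨆ n, U n y s)) x =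
      ⨆ n, heatFlow (t - s) (fun y => ψ y * G (U n y s)) x := by
    simp_rw [heatFlow, h_source, ENNReal.mul_iSup]
    refine lintegral_iSup (fun n => ?_) fun m n hmn y =>
      mul_le_mul_right (h_source_mono s hmn y) _
    have := hG_lsc.measurable.comp ((hU n).comp (f := fun y => (y, s)) (by fun_prop))
    exact (measurable_ofReal_heatKernel_sub x _).mul (hψ.mul this)
  simp_rw [duhamel, h_heatFlow]
  rw [lintegral_iSup, ENNReal.add_iSup]
  · exact fun n => (measurable_heatFlow_source hψ hG_lsc.measurable (hU n)).comp
      (f := fun s : ℝ => ((x, t), s)) (by fun_prop)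
  · exact fun m n hmn s => heatFlow_mono (ae_of_all _ (h_source_mono s hmn)) x

/-- The limit of the Picard iteration of `duhamel` started at `0`. -/
def minimalSolution (ψ : E N → ℝ≥0∞) (G : ℝ≥0∞ → ℝ≥0∞) (w : E N → ℝ≥0∞) (x : E N) (t : ℝ) :
    ℝ≥0∞ :=
  ⨆ n, (duhamel ψ G w)^[n] 0 x t

theorem measurable_iterate_duhamel {ψ : E N → ℝ≥0∞} (hψ : Measurable ψ) {G : ℝ≥0∞ → ℝ≥0∞}
    (hG : Measurable G) {w : E N → ℝ≥0∞} (hw : Measurable w) (n : ℕ) :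
    Measurable (fun p : E N × ℝ => (duhamel ψ G w)^[n] 0 p.1 p.2) := by
  induction n with
  | zero => exact measurable_const
  | succ n ih =>
    simp only [Function.iterate_succ_apply']
    exact measurable_duhamel hψ hG hw ih

theorem measurable_minimalSolution {ψ : E N → ℝ≥0∞} (hψ : Measurable ψ) {G : ℝ≥0∞ → ℝ≥0∞}
    (hG : Measurable G) {w : E N → ℝ≥0∞} (hw : Measurable w) :
    Measurable (fun p : E N × ℝ => minimalSolution ψ G w p.1 p.2) :=
  Measurable.iSup (measurable_iterate_duhamel hψ hG hw)

theorem minimalSolution_eq_duhamel {ψ : E N → ℝ≥0∞} (hψ : Measurable ψ) {G : ℝ≥0∞ → ℝ≥0∞}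
    (hG : Monotone G) (hG_lsc : LowerSemicontinuous G) {w : E N → ℝ≥0∞} (hw : Measurable w)
    (x : E N) (t : ℝ) :
    minimalSolution ψ G w x t = duhamel ψ G w (minimalSolution ψ G w) x t := by
  have h_mono : Monotone fun n => (duhamel ψ G w)^[n] 0 :=
    (monotone_duhamel ψ hG w).monotone_iterate_of_le_map fun _ _ => zero_le
  calc minimalSolution ψ G w x t = ⨆ n, (duhamel ψ G w)^[n + 1] 0 x t :=
        (Monotone.iSup_nat_add (fun m n hmn => h_mono hmn x t) 1).symm
    _ = ⨆ n, duhamel ψ G w ((duhamel ψ G w)^[n] 0) x t := by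
        simp_rw [Function.iterate_succ_apply']
    _ = duhamel ψ G w (minimalSolution ψ G w) x t :=
        (duhamel_iSup hψ hG hG_lsc w (measurable_iterate_duhamel hψ hG_lsc.measurable hw)
          h_mono x t).symm

theorem minimalSolution_le_of_duhamel_le {ψ : E N → ℝ≥0∞} {G : ℝ≥0∞ → ℝ≥0∞} (hG : Monotone G)
    {w : E N → ℝ≥0∞} {V : E N → ℝ → ℝ≥0∞} {T : ℝ}
    (hV : ∀ t ∈ Ioo 0 T, ∀ x, duhamel ψ G w V x t ≤ V x t) {t : ℝ} (ht : t ∈ Ioo 0 T) (x : E N) :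
    minimalSolution ψ G w x t ≤ V x t := by
  have h_iterate (n : ℕ) : ∀ t ∈ Ioo 0 T, ∀ x, (duhamel ψ G w)^[n] 0 x t ≤ V x t := by
    induction n with
    | zero => exact fun _ _ _ => zero_le
    | succ n ih =>
      intro t ht x
      rw [Function.iterate_succ_apply']
      exact (duhamel_le_duhamel hG w (fun s hs => ih s ⟨hs.1, hs.2.trans ht.2⟩) x).trans
        (hV t ht x)
  exact iSup_le fun n => h_iterate n t ht x

/-- The extension of a nonlinearity `f` on `[0,∞)` to `[0,∞]`; the truncation makes the value at
`∞` the supremum of `f`, so that the extension is lower semicontinuous there. -/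
def extendNonneg (f : ℝ → ℝ) (v : ℝ≥0∞) : ℝ≥0∞ :=
  ⨆ n : ℕ, ENNReal.ofReal (f (min v n).toReal)

theorem min_natCast_ne_top (v : ℝ≥0∞) (n : ℕ) : min v n ≠ ⊤ :=
  ((min_le_right v n).trans_lt (ENNReal.natCast_lt_top n)).ne

theorem monotone_extendNonneg {f : ℝ → ℝ} (hf : MonotoneOn f (Ici 0)) :
    Monotone (extendNonneg f) := fun _ v' h => iSup_mono fun n =>
  ENNReal.ofReal_le_ofReal <| hf ENNReal.toReal_nonneg ENNReal.toReal_nonneg <|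
    ENNReal.toReal_mono (min_natCast_ne_top v' n) (min_le_min_right _ h)

theorem lowerSemicontinuous_extendNonneg {f : ℝ → ℝ} (hf : ContinuousOn f (Ici 0)) :
    LowerSemicontinuous (extendNonneg f) := by
  refine lowerSemicontinuous_iSup fun n => Continuous.lowerSemicontinuous ?_
  have h_trunc : Continuous fun v : ℝ≥0∞ => (min v n).toReal :=
    ENNReal.continuousOn_toReal.comp_continuous (by fun_prop) fun _ => min_natCast_ne_top _ n
  exact ENNReal.continuous_ofReal.comp
    (hf.comp_continuous h_trunc fun _ => ENNReal.toReal_nonneg)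

theorem extendNonneg_of_ne_top {f : ℝ → ℝ} (hf : MonotoneOn f (Ici 0)) {v : ℝ≥0∞} (hv : v ≠ ⊤) :
    extendNonneg f v = ENNReal.ofReal (f v.toReal) := by
  refine le_antisymm (iSup_le fun n => ENNReal.ofReal_le_ofReal ?_) ?_
  · exact hf ENNReal.toReal_nonneg ENNReal.toReal_nonneg
      (ENNReal.toReal_mono hv (min_le_left v n))
  · obtain ⟨n, hn⟩ := ENNReal.exists_nat_gt hv
    calc ENNReal.ofReal (f v.toReal) = ENNReal.ofReal (f (min v n).toReal) := by
          rw [min_eq_left hn.le]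
      _ ≤ extendNonneg f v := le_iSup (fun n : ℕ => ENNReal.ofReal (f (min v n).toReal)) n

/-- The conditions of `CondH` on `H`, with `C²` weakened to differentiability. -/
structure GrowthFunction (H : ℝ → ℝ) : Prop where
  differentiableOn : DifferentiableOn ℝ H (Ici 0)
  tendsto : Tendsto H atTop atTop
  pos : ∀ ξ, 0 < ξ → 0 < H ξ
  deriv_pos : ∀ ξ, 0 < ξ → 0 < D H ξ
  deriv_mono : ∃ R : ℝ, 0 < R ∧ MonotoneOn (D H) (Ici R)

theorem CondH.growthFunction {H : ℝ → ℝ} (hH : CondH H) : GrowthFunction H where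
  differentiableOn := hH.contDiff.differentiableOn two_ne_zero
  tendsto := hH.tendsto
  pos := hH.pos
  deriv_pos := hH.deriv_pos
  deriv_mono := hH.deriv_mono

/-- The inverse of the restriction of `H` to `[R,∞)`. -/
def inverseAbove (H : ℝ → ℝ) (R : ℝ) : ℝ → ℝ := Function.invFunOn H (Ici R)

namespace GrowthFunction

variable {H : ℝ → ℝ}

theorem hasDerivAt (hH : GrowthFunction H) {ξ : ℝ} (hξ : 0 < ξ) : HasDerivAt H (D H ξ) ξ :=
  (hH.differentiableOn ξ hξ.le).hasDerivWithinAt.hasDerivAt (Ici_mem_nhds hξ)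

theorem strictMonoOn (hH : GrowthFunction H) : StrictMonoOn H (Ici 0) := by
  refine strictMonoOn_of_deriv_pos (convex_Ici 0) hH.differentiableOn.continuousOn fun ξ hξ => ?_
  rw [interior_Ici] at hξ
  rw [(hH.hasDerivAt hξ).deriv]
  exact hH.deriv_pos ξ hξ

theorem monotoneOn_Ici (hH : GrowthFunction H) {R : ℝ} (hR : 0 ≤ R) : MonotoneOn H (Ici R) :=
  hH.strictMonoOn.monotoneOn.mono (Ici_subset_Ici.2 hR)

theorem nonneg (hH : GrowthFunction H) {ξ : ℝ} (hξ : 0 ≤ ξ) : 0 ≤ H ξ := by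
  have h_lim : Tendsto H (𝓝[>] 0) (𝓝 (H 0)) :=
    (hH.differentiableOn.continuousOn 0 self_mem_Ici).mono_left
      (nhdsWithin_mono _ Ioi_subset_Ici_self)
  have h_zero : 0 ≤ H 0 :=
    ge_of_tendsto h_lim (eventually_nhdsWithin_of_forall fun y hy => (hH.pos y hy).le)
  exact h_zero.trans (hH.strictMonoOn.monotoneOn self_mem_Ici hξ hξ)

theorem apply_max_le_add (hH : GrowthFunction H) {a b : ℝ} (ha : 0 ≤ a) (hb : 0 ≤ b) :
    H (max a b) ≤ H a + H b := by
  rcases max_choice a b with h | h <;> rw [h] <;> linarith [hH.nonneg ha, hH.nonneg hb]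

theorem convexOn (hH : GrowthFunction H) {R : ℝ} (hR0 : 0 < R) (hR : MonotoneOn (D H) (Ici R)) :
    ConvexOn ℝ (Ici R) H := by
  have h_sub : interior (Ici R) ⊆ Ici R := interior_subset
  refine MonotoneOn.convexOn_of_deriv (convex_Ici R)
    (hH.differentiableOn.continuousOn.mono (Ici_subset_Ici.2 hR0.le))
    (fun ξ hξ => (hH.hasDerivAt (hR0.trans_le (h_sub hξ))).differentiableAt.differentiableWithinAt)
    ((hR.mono h_sub).congr fun ξ hξ => ?_)
  exact (hH.hasDerivAt (hR0.trans_le (h_sub hξ))).deriv.symm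

theorem add_deriv_mul_le (hH : GrowthFunction H) {R : ℝ} (hR0 : 0 < R)
    (hR : MonotoneOn (D H) (Ici R)) {p y : ℝ} (hp : R ≤ p) (hy : R ≤ y) :
    H p + D H p * (y - p) ≤ H y := by
  have h_convex := hH.convexOn hR0 hR
  have h_deriv := hH.hasDerivAt (hR0.trans_le hp)
  rcases lt_trichotomy p y with h | rfl | h
  · have h_slope := h_convex.le_slope_of_hasDerivAt hp hy h h_deriv
    rw [slope_def_field, le_div_iff₀ (sub_pos.2 h)] at h_slope
    linarith
  · simp only [sub_self, mul_zero, add_zero, le_refl]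
  · have h_slope := h_convex.slope_le_of_hasDerivAt hy hp h h_deriv
    rw [slope_def_field, div_le_iff₀ (sub_pos.2 h)] at h_slope
    linarith

theorem surjOn_Ici (hH : GrowthFunction H) {R : ℝ} (hR : 0 ≤ R) :
    SurjOn H (Ici R) (Ici (H R)) := by
  intro z hz
  obtain ⟨b, hzb, hRb⟩ :=
    ((hH.tendsto.eventually_ge_atTop z).and (eventually_ge_atTop R)).exists
  obtain ⟨y, hy, hyz⟩ := intermediate_value_Icc hRb
    (hH.differentiableOn.continuousOn.mono fun x hx => hR.trans hx.1) ⟨hz, hzb⟩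
  exact ⟨y, hy.1, hyz⟩

theorem le_inverseAbove (hH : GrowthFunction H) {R : ℝ} (hR : 0 ≤ R) {z : ℝ} (hz : H R ≤ z) :
    R ≤ inverseAbove H R z :=
  (hH.surjOn_Ici hR).mapsTo_invFunOn hz

theorem apply_inverseAbove (hH : GrowthFunction H) {R : ℝ} (hR : 0 ≤ R) {z : ℝ} (hz : H R ≤ z) :
    H (inverseAbove H R z) = z :=
  (hH.surjOn_Ici hR).rightInvOn_invFunOn hz

theorem inverseAbove_apply (hH : GrowthFunction H) {R : ℝ} (hR : 0 ≤ R) {y : ℝ} (hy : R ≤ y) :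
    inverseAbove H R (H y) = y :=
  (hH.strictMonoOn.injOn.mono (Ici_subset_Ici.2 hR)).leftInvOn_invFunOn hy

theorem inverseAbove_le_iff (hH : GrowthFunction H) {R : ℝ} (hR : 0 ≤ R) {z y : ℝ} (hz : H R ≤ z)
    (hy : 0 ≤ y) : inverseAbove H R z ≤ y ↔ z ≤ H y := by
  rw [← hH.strictMonoOn.le_iff_le (hR.trans (hH.le_inverseAbove hR hz)) hy,
    hH.apply_inverseAbove hR hz]

end GrowthFunction

/-- The supremum of `d / h ^ p` over `[ζ,ξ]`, the common form of `Phi` and `Psi`. -/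
def ratioSup (d h : ℝ → ℝ) (p ζ ξ : ℝ) : ℝ≥0∞ :=
  ⨆ σ ∈ Icc ζ ξ, ENNReal.ofReal (d σ) / ENNReal.ofReal (h σ) ^ p

theorem div_rpow_le_ratioSup (d h : ℝ → ℝ) (p : ℝ) {ζ ξ σ : ℝ} (hσ : σ ∈ Icc ζ ξ) :
    ENNReal.ofReal (d σ) / ENNReal.ofReal (h σ) ^ p ≤ ratioSup d h p ζ ξ :=
  le_iSup₂ (f := fun σ (_ : σ ∈ Icc ζ ξ) => ENNReal.ofReal (d σ) / ENNReal.ofReal (h σ) ^ p) σ hσ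

theorem ofReal_le_ratioSup_mul (d : ℝ → ℝ) {h : ℝ → ℝ} {p : ℝ} {ζ ξ σ : ℝ}
    (hσ : σ ∈ Icc ζ ξ) (hpos : 0 < h σ) :
    ENNReal.ofReal (d σ) ≤ ratioSup d h p ζ ξ * ENNReal.ofReal (h σ) ^ p := by
  have h0 : ENNReal.ofReal (h σ) ^ p ≠ 0 := by
    simp [ENNReal.rpow_eq_zero_iff, not_le.2 hpos]
  have htop : ENNReal.ofReal (h σ) ^ p ≠ ⊤ := by
    simp [ENNReal.rpow_eq_top_iff, not_le.2 hpos]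
  exact (ENNReal.div_le_iff h0 htop).1 (div_rpow_le_ratioSup d h p hσ)

theorem div_rpow_le_mul_div_rpow {d a b κ : ℝ≥0∞} (hκ : 1 ≤ κ) (hκ_top : κ ≠ ⊤)
    (hb : b ≤ κ * a) {p : ℝ} (hp0 : 0 ≤ p) (hp1 : p ≤ 1) : d / a ^ p ≤ κ * (d / b ^ p) := by
  have hκ0 : κ ≠ 0 := (zero_lt_one.trans_le hκ).ne'
  have h_rpow : b ^ p ≤ κ * a ^ p := by
    calc b ^ p ≤ (κ * a) ^ p := ENNReal.rpow_le_rpow hb hp0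
      _ = κ ^ p * a ^ p := ENNReal.mul_rpow_of_nonneg _ _ hp0
      _ ≤ κ * a ^ p := by
          gcongr
          exact (ENNReal.rpow_le_rpow_of_exponent_le hκ hp1).trans_eq (ENNReal.rpow_one κ)
  calc d / a ^ p = κ * (d / (κ * a ^ p)) := by
        rw [div_eq_mul_inv, div_eq_mul_inv, ENNReal.mul_inv (Or.inl hκ0) (Or.inl hκ_top),
          mul_left_comm d, ← mul_assoc, ENNReal.mul_inv_cancel hκ0 hκ_top, one_mul]
    _ ≤ κ * (d / b ^ p) := by gcongr

theorem ratioSup_le_mul_ratioSup {d h : ℝ → ℝ} {R : ℝ} (hd : MonotoneOn d (Ici R))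
    (hh : MonotoneOn h (Ici R)) (hR : 0 < h R) {p : ℝ} (hp0 : 0 ≤ p) (hp1 : p ≤ 1) {ζ ξ : ℝ}
    (hξ : max R ζ ≤ ξ) :
    ratioSup d h p R ξ ≤ ENNReal.ofReal (h (max R ζ) / h R) * ratioSup d h p ζ ξ := by
  have hκ : 1 ≤ h (max R ζ) / h R :=
    (one_le_div hR).2 (hh self_mem_Ici (le_max_left R ζ) (le_max_left R ζ))
  refine iSup₂_le fun σ hσ => ?_
  have h_max : h (max σ ζ) ≤ h (max R ζ) / h R * h σ := by
    have hσR : h R ≤ h σ := hh self_mem_Ici hσ.1 hσ.1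
    rcases le_total ζ σ with hle | hle
    · rw [max_eq_left hle]
      exact le_mul_of_one_le_left (hR.le.trans hσR) hκ
    · rw [max_eq_right hle, max_eq_right (hσ.1.trans hle)] at *
      calc h ζ = h ζ / h R * h R := by field_simp
        _ ≤ h ζ / h R * h σ := by gcongr
  calc ENNReal.ofReal (d σ) / ENNReal.ofReal (h σ) ^ p
      ≤ ENNReal.ofReal (d (max σ ζ)) / ENNReal.ofReal (h σ) ^ p := by
        gcongr
        exact hd hσ.1 (hσ.1.trans (le_max_left σ ζ)) (le_max_left σ ζ)
    _ ≤ ENNReal.ofReal (h (max R ζ) / h R) *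
          (ENNReal.ofReal (d (max σ ζ)) / ENNReal.ofReal (h (max σ ζ)) ^ p) := by
        refine div_rpow_le_mul_div_rpow (ENNReal.one_le_ofReal.2 hκ) ENNReal.ofReal_ne_top ?_
          hp0 hp1
        rw [← ENNReal.ofReal_mul (zero_le_one.trans hκ)]
        exact ENNReal.ofReal_le_ofReal h_max
    _ ≤ ENNReal.ofReal (h (max R ζ) / h R) * ratioSup d h p ζ ξ := by
        gcongr
        exact div_rpow_le_ratioSup d h p
          ⟨le_max_right σ ζ, max_le hσ.2 ((le_max_right R ζ).trans hξ)⟩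

theorem GrowthFunction.quantity_le_const_mul {H : ℝ → ℝ} (hH : GrowthFunction H) {R : ℝ}
    (hR0 : 0 < R) (hR : MonotoneOn (D H) (Ici R)) (γ : ℝ) {f : ℝ → ℝ} (hf : MonotoneOn f (Ici R))
    {θ : ℝ} (hθ0 : 0 ≤ θ) (hθ1 : θ ≤ 1) {ζ η : ℝ} (hη : max R ζ ≤ η) :
    quantity N γ f H θ R η ≤
      ENNReal.ofReal (H (max R ζ) / H R) ^ 2 * quantity N γ f H θ ζ η := by
  have hH_mono := hH.monotoneOn_Ici hR0.le
  have hHR := hH.pos R hR0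
  rw [sq, quantity, quantity, mul_mul_mul_comm, ← lintegral_const_mul' _ _ ENNReal.ofReal_ne_top]
  refine mul_le_mul' (ratioSup_le_mul_ratioSup hR hH_mono hHR (sub_nonneg.2 hθ1) (by linarith) hη)
    (setLIntegral_mono' measurableSet_Ioi fun τ hτ => ?_)
  rw [← mul_assoc]
  gcongr
  exact ratioSup_le_mul_ratioSup hf hH_mono hHR hθ0 hθ1 (hη.trans (le_of_lt hτ))

/-- The profile `A * s ^ (-N/2)`, the rate at which a heat flow on `ℝ^N` can blow up as `s → 0`. -/
def heatLevel (N : ℕ) (A s : ℝ) : ℝ := A * s ^ (-((N : ℝ) / 2))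

/-- The time `s = (A / z) ^ (2/N)` at which `heatLevel N A s` equals `z`. -/
def levelTime (N : ℕ) (A z : ℝ) : ℝ := (A / z) ^ (2 / (N : ℝ))

theorem heatLevel_pos {A s : ℝ} (hA : 0 < A) (hs : 0 < s) : 0 < heatLevel N A s :=
  mul_pos hA (Real.rpow_pos_of_pos hs _)

theorem levelTime_pos {A z : ℝ} (hA : 0 < A) (hz : 0 < z) : 0 < levelTime N A z :=
  Real.rpow_pos_of_pos (div_pos hA hz) _

theorem heatLevel_levelTime (hN : N ≠ 0) {A z : ℝ} (hA : 0 < A) (hz : 0 < z) :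
    heatLevel N A (levelTime N A z) = z := by
  have hN' : (N : ℝ) ≠ 0 := Nat.cast_ne_zero.2 hN
  rw [heatLevel, levelTime, ← Real.rpow_mul (div_pos hA hz).le,
    show 2 / (N : ℝ) * -(N / 2) = -1 by field_simp, Real.rpow_neg_one]
  field_simp

theorem levelTime_heatLevel_div (hN : N ≠ 0) {A t z : ℝ} (hA : 0 < A) (ht : 0 < t) (hz : 0 < z) :
    levelTime N A z / t = (heatLevel N A t / z) ^ (2 / (N : ℝ)) := by
  have hN' : (N : ℝ) ≠ 0 := Nat.cast_ne_zero.2 hN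
  rw [heatLevel, levelTime, mul_div_right_comm, Real.mul_rpow (div_pos hA hz).le (by positivity),
    ← Real.rpow_mul ht.le, show -((N : ℝ) / 2) * (2 / N) = -1 by field_simp, Real.rpow_neg_one,
    div_eq_mul_inv]

theorem levelTime_heatLevel (hN : N ≠ 0) {A s : ℝ} (hA : 0 < A) (hs : 0 < s) :
    levelTime N A (heatLevel N A s) = s := by
  have h_pos := heatLevel_pos (N := N) hA hs
  rw [← div_left_inj' hs.ne', levelTime_heatLevel_div hN hA hs h_pos, div_self h_pos.ne',
    div_self hs.ne', Real.one_rpow]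

theorem heatLevel_lt_heatLevel (hN : N ≠ 0) {A s t : ℝ} (hA : 0 < A) (hs : 0 < s) (hst : s < t) :
    heatLevel N A t < heatLevel N A s := by
  have h_neg : -((N : ℝ) / 2) < 0 :=
    neg_lt_zero.2 (half_pos (Nat.cast_pos.2 (Nat.pos_of_ne_zero hN)))
  exact mul_lt_mul_of_pos_left (Real.rpow_lt_rpow_of_neg hs hst h_neg) hA

theorem GrowthFunction.hasDerivAt_levelTime {H : ℝ → ℝ} (hH : GrowthFunction H) {A τ : ℝ}
    (hA : 0 < A) (hτ : 0 < τ) :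
    HasDerivAt (fun τ => levelTime N A (H τ))
      (-(2 / N * (levelTime N A (H τ) * (D H τ / H τ)))) τ := by
  have h_pos := hH.pos τ hτ
  have h_ratio := div_pos hA h_pos
  have h_deriv := ((hasDerivAt_const τ A).div (hH.hasDerivAt hτ) h_pos.ne').rpow_const
    (p := 2 / (N : ℝ)) (Or.inl h_ratio.ne')
  refine h_deriv.congr_deriv ?_
  rw [levelTime, Pi.div_apply, Real.rpow_sub_one h_ratio.ne']
  field_simp
  ring

theorem GrowthFunction.Ioo_subset_image_levelTime (hN : N ≠ 0) {H : ℝ → ℝ}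
    (hH : GrowthFunction H) {A t η : ℝ} (hA : 0 < A) (hη : 0 ≤ η) (hHη : H η = heatLevel N A t) :
    Ioo 0 t ⊆ (fun τ => levelTime N A (H τ)) '' Ioi η := by
  intro s hs
  have h_lt : H η < heatLevel N A s := hHη.trans_lt (heatLevel_lt_heatLevel hN hA hs.1 hs.2)
  obtain ⟨τ, hτ, hHτ⟩ := hH.surjOn_Ici hη h_lt.le
  refine ⟨τ, (hH.strictMonoOn.lt_iff_lt hη (hη.trans hτ)).1 (hHτ ▸ h_lt), ?_⟩
  simp only [hHτ, levelTime_heatLevel hN hA hs.1]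

theorem levelTime_mul_rpow_neg {A z : ℝ} (hA : 0 < A) (hz : 0 < z) (γ : ℝ) :
    levelTime N A z * levelTime N A z ^ (-(γ / 2)) =
      A ^ ((2 - γ) / (N : ℝ)) / z ^ ((2 - γ) / (N : ℝ)) := by
  have h_ratio := div_pos hA hz
  rw [levelTime, ← Real.rpow_mul h_ratio.le, ← Real.rpow_add h_ratio, ← Real.div_rpow hA.le hz.le]
  congr 1
  ring

theorem levelTime_integrand_eq (hN : N ≠ 0) {A t z : ℝ} (hA : 0 < A) (ht : 0 < t) (hz : 0 < z)
    (htz : heatLevel N A t ≤ z) (γ d : ℝ) :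
    2 / N * (levelTime N A z * (d / z)) *
        (levelTime N A z * (t - levelTime N A z) / t) ^ (-(γ / 2)) =
      2 / N * A ^ ((2 - γ) / (N : ℝ)) * (d / z ^ (1 + (2 - γ) / (N : ℝ)) *
        (1 - (heatLevel N A t / z) ^ (2 / (N : ℝ))) ^ (-(γ / 2))) := by
  have h_le_one : (heatLevel N A t / z) ^ (2 / (N : ℝ)) ≤ 1 :=
    Real.rpow_le_one (div_pos (heatLevel_pos hA ht) hz).le ((div_le_one hz).2 htz) (by positivity)
  have h_split : levelTime N A z * (t - levelTime N A z) / t =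
      levelTime N A z * (1 - (heatLevel N A t / z) ^ (2 / (N : ℝ))) := by
    rw [← levelTime_heatLevel_div hN hA ht hz]
    field_simp
  rw [h_split, Real.mul_rpow (levelTime_pos hA hz).le (sub_nonneg.2 h_le_one), Real.rpow_add hz,
    Real.rpow_one]
  linear_combination 2 / (N : ℝ) * (d / z) *
    (1 - (heatLevel N A t / z) ^ (2 / (N : ℝ))) ^ (-(γ / 2)) * levelTime_mul_rpow_neg hA hz γ

theorem GrowthFunction.lintegral_comp_heatLevel_le (hN : N ≠ 0) {H : ℝ → ℝ}
    (hH : GrowthFunction H) {R : ℝ} (hR : 0 < R) {A t η : ℝ} (hA : 0 < A) (ht : 0 < t)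
    (hη : R ≤ η) (hHη : H η = heatLevel N A t) (γ : ℝ) (P : ℝ → ℝ≥0∞) :
    ∫⁻ s in Ioo 0 t, P (inverseAbove H R (heatLevel N A s)) *
        ENNReal.ofReal ((s * (t - s) / t) ^ (-(γ / 2))) ≤
      ENNReal.ofReal (2 / N * A ^ ((2 - γ) / (N : ℝ))) * ∫⁻ τ in Ioi η, P τ *
        ENNReal.ofReal (D H τ / H τ ^ (1 + (2 - γ) / (N : ℝ)) *
          (1 - (H η / H τ) ^ (2 / (N : ℝ))) ^ (-(γ / 2))) := by
  have hη0 : 0 < η := hR.trans_le hη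
  have h_inj : InjOn (fun τ => levelTime N A (H τ)) (Ioi η) := fun a ha b hb hab =>
    hH.strictMonoOn.injOn (hη0.trans ha).le (hη0.trans hb).le <| by
      rw [← heatLevel_levelTime hN hA (hH.pos a (hη0.trans ha)),
        ← heatLevel_levelTime hN hA (hH.pos b (hη0.trans hb))]
      exact congrArg (heatLevel N A) hab
  refine (lintegral_mono_set (hH.Ioo_subset_image_levelTime hN hA hη0.le hHη)).trans ?_
  rw [lintegral_image_eq_lintegral_abs_deriv_mul measurableSet_Ioi
      (fun τ hτ => (hH.hasDerivAt_levelTime hA (hη0.trans hτ)).hasDerivWithinAt) h_inj,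
    ← lintegral_const_mul' _ _ ENNReal.ofReal_ne_top]
  refine setLIntegral_mono' measurableSet_Ioi fun τ hτ => le_of_eq ?_
  have hτ0 : 0 < τ := hη0.trans hτ
  have hHτ := hH.pos τ hτ0
  have h_abs_nonneg : 0 ≤ 2 / N * (levelTime N A (H τ) * (D H τ / H τ)) :=
    mul_nonneg (by positivity)
      (mul_pos (levelTime_pos hA hHτ) (div_pos (hH.deriv_pos τ hτ0) hHτ)).le
  rw [abs_neg, abs_of_nonneg h_abs_nonneg, heatLevel_levelTime hN hA hHτ,
    hH.inverseAbove_apply hR.le (hη.trans (le_of_lt hτ)), mul_left_comm, mul_left_comm _ (P τ),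
    ← ENNReal.ofReal_mul h_abs_nonneg, ← ENNReal.ofReal_mul (by positivity), hHη,
    levelTime_integrand_eq hN hA ht hHτ (hHη ▸ (hH.strictMonoOn hη0.le hτ0.le hτ).le)]

theorem le_heatFlow_of_le {t : ℝ} (ht : 0 < t) {c : ℝ≥0∞} {φ : E N → ℝ≥0∞} (h : ∀ y, c ≤ φ y)
    (x : E N) : c ≤ heatFlow t φ x :=
  (heatFlow_const ht c x).symm.trans_le (heatFlow_mono (ae_of_all _ h) x)

theorem heatFlow_hardyWeight_mul_rpow_le {γ : ℝ} (hγ : 0 ≤ γ) {s t : ℝ} (hs : 0 < s) (hst : s < t)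
    {φ : E N → ℝ≥0∞} (hφ : Measurable φ) {θ : ℝ} (hθ0 : 0 ≤ θ) (hθ1 : θ ≤ 1) (x : E N) :
    heatFlow (t - s) (fun y => hardyWeight γ y * heatFlow s φ y ^ θ) x ≤
      hardyConst N γ * ENNReal.ofReal ((s * (t - s) / t) ^ (-(γ / 2))) * heatFlow t φ x ^ θ := by
  set B := hardyConst N γ * ENNReal.ofReal ((s * (t - s) / t) ^ (-(γ / 2)))
  have ht : 0 < t := hs.trans hst
  have h_bridge_pos : 0 < s * (t - s) / t := div_pos (mul_pos hs (sub_pos.2 hst)) ht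
  have h_bridge_le : s * (t - s) / t ≤ t - s := by
    rw [div_le_iff₀ ht, mul_comm]
    exact mul_le_mul_of_nonneg_left hst.le (sub_nonneg.2 hst.le)
  have h_weight : heatFlow (t - s) (hardyWeight γ) x ≤ B :=
    (heatFlow_hardyWeight_le hγ (sub_pos.2 hst) x).trans <| by
      refine mul_le_mul_right (ENNReal.ofReal_le_ofReal ?_) _
      exact Real.rpow_le_rpow_of_nonpos h_bridge_pos h_bridge_le (by linarith)
  have h_weight_mul := heatFlow_weight_mul_heatFlow_le hs hst (measurable_hardyWeight γ) hφ
    (fun m => heatFlow_hardyWeight_le hγ h_bridge_pos m) x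
  have h_flow : Measurable fun y => heatFlow s φ y :=
    measurable_heatFlow (φ := fun _ => φ) measurable_const measurable_id (hφ.comp measurable_snd)
  calc heatFlow (t - s) (fun y => hardyWeight γ y * heatFlow s φ y ^ θ) x
      ≤ heatFlow (t - s) (hardyWeight γ) x ^ (1 - θ) *
          heatFlow (t - s) (fun y => hardyWeight γ y * heatFlow s φ y) x ^ θ :=
        heatFlow_weight_mul_rpow_le _ (measurable_hardyWeight γ) h_flow hθ0 hθ1 x
    _ ≤ B ^ (1 - θ) * (B * heatFlow t φ x) ^ θ := by gcongr
    _ = B * heatFlow t φ x ^ θ := by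
        rw [ENNReal.mul_rpow_of_nonneg _ _ hθ0, ← mul_assoc,
          ← ENNReal.rpow_add_of_nonneg _ _ (sub_nonneg.2 hθ1) hθ0, sub_add_cancel,
          ENNReal.rpow_one]

/-- The function `H⁻¹(2 e^{tΔ} φ)`, which is a supersolution of the integral equation for
`φ = H(w)`. -/
def barrier (H : ℝ → ℝ) (R : ℝ) (φ : E N → ℝ≥0∞) (x : E N) (t : ℝ) : ℝ :=
  inverseAbove H R (2 * heatFlow t φ x).toReal

/-- The constant by which `quantity` has to be multiplied to bound the Duhamel term of the
barrier relative to `e^{tΔ} φ` when `2 e^{tΔ} φ ≤ A t ^ (-N/2)`. -/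
def sourceConst (N : ℕ) (γ A : ℝ) : ℝ≥0∞ :=
  2 * hardyConst N γ * ENNReal.ofReal (2 / N * A ^ ((2 - γ) / (N : ℝ)))

namespace GrowthFunction

variable {H : ℝ → ℝ} {R : ℝ} {φ : E N → ℝ≥0∞} {t : ℝ} {x : E N}

theorem le_toReal_two_mul_heatFlow (h_lo : ENNReal.ofReal (H R) ≤ heatFlow t φ x)
    (h_fin : 2 * heatFlow t φ x ≠ ⊤) : H R ≤ (2 * heatFlow t φ x).toReal :=
  (ENNReal.ofReal_le_iff_le_toReal h_fin).1
    (h_lo.trans (le_mul_of_one_le_left' one_le_two))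

theorem le_barrier (hH : GrowthFunction H) (hR : 0 ≤ R)
    (h_lo : ENNReal.ofReal (H R) ≤ heatFlow t φ x) (h_fin : 2 * heatFlow t φ x ≠ ⊤) :
    R ≤ barrier H R φ x t :=
  hH.le_inverseAbove hR (le_toReal_two_mul_heatFlow h_lo h_fin)

theorem ofReal_apply_barrier (hH : GrowthFunction H) (hR : 0 ≤ R)
    (h_lo : ENNReal.ofReal (H R) ≤ heatFlow t φ x) (h_fin : 2 * heatFlow t φ x ≠ ⊤) :
    ENNReal.ofReal (H (barrier H R φ x t)) = 2 * heatFlow t φ x := by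
  rw [barrier, hH.apply_inverseAbove hR (le_toReal_two_mul_heatFlow h_lo h_fin),
    ENNReal.ofReal_toReal h_fin]

theorem barrier_mem_Icc (hH : GrowthFunction H) (hR : 0 ≤ R) {z : ℝ} (hz : 0 ≤ z)
    (h_lo : ENNReal.ofReal (H R) ≤ heatFlow t φ x)
    (h_hi : 2 * heatFlow t φ x ≤ ENNReal.ofReal z) :
    barrier H R φ x t ∈ Icc R (inverseAbove H R z) := by
  have h_fin := ne_top_of_le_ne_top ENNReal.ofReal_ne_top h_hi
  have h_le := le_toReal_two_mul_heatFlow h_lo h_fin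
  have h_toReal : (2 * heatFlow t φ x).toReal ≤ z := ENNReal.toReal_le_of_le_ofReal hz h_hi
  refine ⟨hH.le_barrier hR h_lo h_fin, (hH.inverseAbove_le_iff hR h_le
    (hR.trans (hH.le_inverseAbove hR (h_le.trans h_toReal)))).2 ?_⟩
  rwa [hH.apply_inverseAbove hR (h_le.trans h_toReal)]

theorem deriv_mul_heatFlow_add_le (hH : GrowthFunction H) (hR0 : 0 < R)
    (hR : MonotoneOn (D H) (Ici R)) {w : E N → ℝ} (hw : Measurable w) (hwR : ∀ y, R ≤ w y)
    (ht : 0 < t) {p : ℝ} (hp : R ≤ p) :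
    ENNReal.ofReal (D H p) * heatFlow t (fun y => ENNReal.ofReal (w y)) x + ENNReal.ofReal (H p) ≤
      ENNReal.ofReal (D H p) * ENNReal.ofReal p +
        heatFlow t (fun y => ENNReal.ofReal (H (w y))) x := by
  have hp0 : 0 < p := hR0.trans_le hp
  have hD := (hH.deriv_pos p hp0).le
  have h_pointwise (y : E N) :
      ENNReal.ofReal (D H p) * ENNReal.ofReal (w y) + ENNReal.ofReal (H p) ≤
        ENNReal.ofReal (D H p) * ENNReal.ofReal p + ENNReal.ofReal (H (w y)) := by
    have hw0 : 0 < w y := hR0.trans_le (hwR y)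
    rw [← ENNReal.ofReal_mul hD, ← ENNReal.ofReal_mul hD,
      ← ENNReal.ofReal_add (mul_nonneg hD hw0.le) (hH.pos p hp0).le,
      ← ENNReal.ofReal_add (mul_nonneg hD hp0.le) (hH.pos _ hw0).le]
    refine ENNReal.ofReal_le_ofReal ?_
    linarith [hH.add_deriv_mul_le hR0 hR hp (hwR y)]
  have h_flow := heatFlow_mono (t := t) (ae_of_all _ h_pointwise) x
  rwa [heatFlow_add _ (by fun_prop), heatFlow_add _ (by fun_prop),
    heatFlow_const_mul _ _ (by fun_prop), heatFlow_const ht, heatFlow_const ht] at h_flow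

theorem ofReal_apply_barrier_le_ratioSup_mul (hH : GrowthFunction H) (hR : 0 < R) (d : ℝ → ℝ)
    (p : ℝ) {z : ℝ} (hz : 0 ≤ z) (h_lo : ENNReal.ofReal (H R) ≤ heatFlow t φ x)
    (h_hi : 2 * heatFlow t φ x ≤ ENNReal.ofReal z) :
    ENNReal.ofReal (d (barrier H R φ x t)) ≤
      ratioSup d H p R (inverseAbove H R z) * (2 * heatFlow t φ x) ^ p := by
  have h_mem := hH.barrier_mem_Icc hR.le hz h_lo h_hi
  rw [← hH.ofReal_apply_barrier hR.le h_lo (ne_top_of_le_ne_top ENNReal.ofReal_ne_top h_hi)]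
  exact ofReal_le_ratioSup_mul d h_mem (hH.pos _ (hR.trans_le h_mem.1))

variable {A : ℝ}

theorem lintegral_source_barrier_le (hH : GrowthFunction H) (hR : 0 < R) {γ : ℝ} (hγ0 : 0 ≤ γ)
    (hγN : γ < N) (f : ℝ → ℝ) {θ : ℝ} (hθ0 : 0 ≤ θ) (hθ1 : θ ≤ 1) (hA : 0 < A)
    (hφ : Measurable φ) (hφ_lo : ∀ y, ENNReal.ofReal (H R) ≤ φ y)
    (hφ_hi : ∀ s ∈ Ioo 0 t, ∀ y, 2 * heatFlow s φ y ≤ ENNReal.ofReal (heatLevel N A s))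
    (h_fin : heatFlow t φ x ≠ ⊤) :
    ∫⁻ s in Ioo 0 t,
        heatFlow (t - s) (fun y => hardyWeight γ y * ENNReal.ofReal (f (barrier H R φ y s))) x ≤
      hardyConst N γ * (2 * heatFlow t φ x) ^ θ *
        ∫⁻ s in Ioo 0 t, Psi f H θ R (inverseAbove H R (heatLevel N A s)) *
          ENNReal.ofReal ((s * (t - s) / t) ^ (-(γ / 2))) := by
  have h_const : hardyConst N γ * (2 * heatFlow t φ x) ^ θ ≠ ⊤ :=
    ENNReal.mul_ne_top (hardyConst_ne_top hγ0 hγN)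
      (ENNReal.rpow_ne_top_of_nonneg hθ0 (ENNReal.mul_ne_top ENNReal.ofNat_ne_top h_fin))
  rw [← lintegral_const_mul' _ _ h_const]
  refine setLIntegral_mono' measurableSet_Ioo fun s hs => ?_
  set P := Psi f H θ R (inverseAbove H R (heatLevel N A s))
  have h_flow : Measurable fun y => heatFlow s φ y :=
    measurable_heatFlow (φ := fun _ => φ) measurable_const measurable_id (hφ.comp measurable_snd)
  have h_pointwise (y : E N) : hardyWeight γ y * ENNReal.ofReal (f (barrier H R φ y s)) ≤
      P * 2 ^ θ * (hardyWeight γ y * heatFlow s φ y ^ θ) := by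
    calc hardyWeight γ y * ENNReal.ofReal (f (barrier H R φ y s))
        ≤ hardyWeight γ y * (P * (2 * heatFlow s φ y) ^ θ) := by
          gcongr
          exact hH.ofReal_apply_barrier_le_ratioSup_mul hR f θ (heatLevel_pos hA hs.1).le
            (le_heatFlow_of_le hs.1 hφ_lo y) (hφ_hi s hs y)
      _ = P * 2 ^ θ * (hardyWeight γ y * heatFlow s φ y ^ θ) := by
          rw [ENNReal.mul_rpow_of_nonneg _ _ hθ0]
          ring
  calc heatFlow (t - s) (fun y => hardyWeight γ y * ENNReal.ofReal (f (barrier H R φ y s))) x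
      ≤ P * 2 ^ θ * heatFlow (t - s) (fun y => hardyWeight γ y * heatFlow s φ y ^ θ) x := by
        rw [← heatFlow_const_mul _ _ (by fun_prop)]
        exact heatFlow_mono (ae_of_all _ h_pointwise) x
    _ ≤ P * 2 ^ θ * (hardyConst N γ * ENNReal.ofReal ((s * (t - s) / t) ^ (-(γ / 2))) *
          heatFlow t φ x ^ θ) := by
        gcongr
        exact heatFlow_hardyWeight_mul_rpow_le hγ0 hs.1 hs.2 hφ hθ0 hθ1 x
    _ = _ := by
        rw [ENNReal.mul_rpow_of_nonneg _ _ hθ0]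
        ring

theorem deriv_mul_lintegral_source_barrier_le (hH : GrowthFunction H) (hR : 0 < R) {γ : ℝ}
    (hγ0 : 0 ≤ γ) (hγN : γ < N) (f : ℝ → ℝ) {θ : ℝ} (hθ0 : 0 ≤ θ) (hθ1 : θ ≤ 1) (hA : 0 < A)
    (ht : 0 < t) (hφ : Measurable φ) (hφ_lo : ∀ y, ENNReal.ofReal (H R) ≤ φ y)
    (hφ_hi : ∀ s ∈ Ioc 0 t, ∀ y, 2 * heatFlow s φ y ≤ ENNReal.ofReal (heatLevel N A s)) :
    ENNReal.ofReal (D H (barrier H R φ x t)) * ∫⁻ s in Ioo 0 t,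
        heatFlow (t - s) (fun y => hardyWeight γ y * ENNReal.ofReal (f (barrier H R φ y s))) x ≤
      sourceConst N γ A * quantity N γ f H θ R (inverseAbove H R (heatLevel N A t)) *
        heatFlow t φ x := by
  have hN : N ≠ 0 := by
    rintro rfl
    exact (hγN.trans_le (by simp)).not_ge hγ0
  set v := heatFlow t φ x
  set η := inverseAbove H R (heatLevel N A t)
  have h_level := (heatLevel_pos (N := N) hA ht).le
  have h_hi : 2 * v ≤ ENNReal.ofReal (heatLevel N A t) := hφ_hi t (right_mem_Ioc.2 ht) x
  have h_lo : ENNReal.ofReal (H R) ≤ v := le_heatFlow_of_le ht hφ_lo x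
  have h_fin : v ≠ ⊤ := ne_top_of_le_ne_top ENNReal.ofReal_ne_top
    ((le_mul_of_one_le_left' one_le_two).trans h_hi)
  have h_le : H R ≤ heatLevel N A t := (ENNReal.ofReal_le_ofReal_iff h_level).1
    (h_lo.trans ((le_mul_of_one_le_left' one_le_two).trans h_hi))
  have h_exponents : (2 * v) ^ (1 - θ) * (2 * v) ^ θ = 2 * v := by
    rw [← ENNReal.rpow_add_of_nonneg _ _ (sub_nonneg.2 hθ1) hθ0, sub_add_cancel, ENNReal.rpow_one]
  calc _ ≤ Phi H θ R η * (2 * v) ^ (1 - θ) * (hardyConst N γ * (2 * v) ^ θ *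
          (ENNReal.ofReal (2 / N * A ^ ((2 - γ) / (N : ℝ))) *
            ∫⁻ τ in Ioi η, Psi f H θ R τ *
              ENNReal.ofReal (D H τ / H τ ^ (1 + (2 - γ) / (N : ℝ)) *
                (1 - (H η / H τ) ^ (2 / (N : ℝ))) ^ (-(γ / 2))))) := by
        refine mul_le_mul'
          (hH.ofReal_apply_barrier_le_ratioSup_mul hR (D H) (1 - θ) h_level h_lo h_hi) ?_
        refine (hH.lintegral_source_barrier_le hR hγ0 hγN f hθ0 hθ1 hA hφ hφ_lo
          (fun s hs => hφ_hi s (Ioo_subset_Ioc_self hs)) h_fin).trans (mul_le_mul_right ?_ _)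
        exact hH.lintegral_comp_heatLevel_le hN hR hA ht (hH.le_inverseAbove hR.le h_le)
          (hH.apply_inverseAbove hR.le h_le) γ _
    _ = (2 * v) ^ (1 - θ) * (2 * v) ^ θ *
          (hardyConst N γ * ENNReal.ofReal (2 / N * A ^ ((2 - γ) / (N : ℝ))) *
            quantity N γ f H θ R η) := by
        rw [quantity]
        ring
    _ = sourceConst N γ A * quantity N γ f H θ R η * v := by
        rw [h_exponents, sourceConst]
        ring

theorem measurable_comp (hH : GrowthFunction H) {w : E N → ℝ} (hw : Measurable w)
    (hw0 : ∀ y, 0 ≤ w y) : Measurable fun y => H (w y) := by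
  have h_mono : Monotone fun ξ => H (max 0 ξ) := fun ξ ξ' h =>
    hH.strictMonoOn.monotoneOn (le_max_left 0 ξ) (le_max_left 0 ξ') (max_le_max_left 0 h)
  simpa only [Function.comp_def, max_eq_right (hw0 _)] using h_mono.measurable.comp hw

theorem deriv_barrier_mul_heatFlow_add_le (hH : GrowthFunction H) (hR0 : 0 < R)
    (hR : MonotoneOn (D H) (Ici R)) {w : E N → ℝ} (hw : Measurable w) (hwR : ∀ y, R ≤ w y)
    (hφ : φ = fun y => ENNReal.ofReal (H (w y))) (ht : 0 < t)
    (h_lo : ENNReal.ofReal (H R) ≤ heatFlow t φ x) (h_fin : 2 * heatFlow t φ x ≠ ⊤) :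
    ENNReal.ofReal (D H (barrier H R φ x t)) * heatFlow t (fun y => ENNReal.ofReal (w y)) x +
        heatFlow t φ x ≤
      ENNReal.ofReal (D H (barrier H R φ x t)) * ENNReal.ofReal (barrier H R φ x t) := by
  have h_tangent := hH.deriv_mul_heatFlow_add_le (x := x) hR0 hR hw hwR ht
    (hH.le_barrier hR0.le h_lo h_fin)
  rw [hH.ofReal_apply_barrier hR0.le h_lo h_fin, ← hφ, two_mul, ← add_assoc] at h_tangent
  refine (ENNReal.add_le_add_iff_right fun h_top => h_fin ?_).1 h_tangent
  rw [h_top, ENNReal.mul_top two_ne_zero]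

theorem duhamel_barrier_le (hH : GrowthFunction H) (hR0 : 0 < R) (hR : MonotoneOn (D H) (Ici R))
    {γ : ℝ} (hγ0 : 0 ≤ γ) (hγN : γ < N) {f : ℝ → ℝ} (hf : MonotoneOn f (Ici 0)) {θ : ℝ}
    (hθ0 : 0 ≤ θ) (hθ1 : θ ≤ 1) (hA : 0 < A) (ht : 0 < t) {w : E N → ℝ} (hw : Measurable w)
    (hwR : ∀ y, R ≤ w y) (hφ : φ = fun y => ENNReal.ofReal (H (w y)))
    (hφ_hi : ∀ s ∈ Ioc 0 t, ∀ y, 2 * heatFlow s φ y ≤ ENNReal.ofReal (heatLevel N A s))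
    (h_quantity : sourceConst N γ A *
      quantity N γ f H θ R (inverseAbove H R (heatLevel N A t)) ≤ 1) (x : E N) :
    duhamel (hardyWeight γ) (extendNonneg f) (fun y => ENNReal.ofReal (w y))
        (fun y s => ENNReal.ofReal (barrier H R φ y s)) x t ≤
      ENNReal.ofReal (barrier H R φ x t) := by
  have hφ_meas : Measurable φ :=
    hφ ▸ (hH.measurable_comp hw fun y => hR0.le.trans (hwR y)).ennreal_ofReal
  have hφ_lo (y : E N) : ENNReal.ofReal (H R) ≤ φ y := by
    rw [hφ]
    exact ENNReal.ofReal_le_ofReal (hH.monotoneOn_Ici hR0.le self_mem_Ici (hwR y) (hwR y))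
  have h_fin {s : ℝ} (hs : s ∈ Ioc 0 t) (y : E N) : 2 * heatFlow s φ y ≠ ⊤ :=
    ne_top_of_le_ne_top ENNReal.ofReal_ne_top (hφ_hi s hs y)
  have h_ge {s : ℝ} (hs : s ∈ Ioc 0 t) (y : E N) : R ≤ barrier H R φ y s :=
    hH.le_barrier hR0.le (le_heatFlow_of_le hs.1 hφ_lo y) (h_fin hs y)
  have ht_mem : t ∈ Ioc 0 t := right_mem_Ioc.2 ht
  set p := barrier H R φ x t
  have hp : R ≤ p := h_ge ht_mem x
  set S := ∫⁻ s in Ioo 0 t,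
    heatFlow (t - s) (fun y => hardyWeight γ y * ENNReal.ofReal (f (barrier H R φ y s))) x
  have h_duhamel : duhamel (hardyWeight γ) (extendNonneg f) (fun y => ENNReal.ofReal (w y))
      (fun y s => ENNReal.ofReal (barrier H R φ y s)) x t =
        heatFlow t (fun y => ENNReal.ofReal (w y)) x + S := by
    refine congrArg (_ + ·) (setLIntegral_congr_fun measurableSet_Ioo fun s hs => ?_)
    simp only [extendNonneg_of_ne_top hf ENNReal.ofReal_ne_top,
      ENNReal.toReal_ofReal (hR0.le.trans (h_ge (Ioo_subset_Ioc_self hs) _))]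
  have h_source : ENNReal.ofReal (D H p) * S ≤ heatFlow t φ x :=
    (hH.deriv_mul_lintegral_source_barrier_le hR0 hγ0 hγN f hθ0 hθ1 hA ht hφ_meas hφ_lo
      hφ_hi).trans (mul_le_of_le_one_left' h_quantity)
  have hD : 0 < D H p := hH.deriv_pos p (hR0.trans_le hp)
  rw [h_duhamel, ← ENNReal.mul_le_mul_iff_right (ENNReal.ofReal_pos.2 hD).ne'
    ENNReal.ofReal_ne_top, mul_add]
  exact (add_le_add_right h_source _).trans (hH.deriv_barrier_mul_heatFlow_add_le hR0 hR hw hwR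
    hφ ht (le_heatFlow_of_le ht hφ_lo x) (h_fin ht_mem x))

end GrowthFunction

theorem tendsto_heatLevel (hN : N ≠ 0) {A : ℝ} (hA : 0 < A) :
    Tendsto (heatLevel N A) (𝓝[>] 0) atTop := by
  have h_neg : -((N : ℝ) / 2) < 0 :=
    neg_lt_zero.2 (half_pos (Nat.cast_pos.2 (Nat.pos_of_ne_zero hN)))
  exact (tendsto_rpow_neg_nhdsGT_zero h_neg).const_mul_atTop hA

/-- The bound `2 e^{tΔ} φ ≤ A t ^ (-N/2)` for all small times. For data in `L¹_ul` it holds for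
large `A`, for data in the closure of `BUC` it holds for every `A > 0`. -/
def HasHeatBound (φ : E N → ℝ≥0∞) (A : ℝ) : Prop :=
  ∀ᶠ t in 𝓝[>] 0, ∀ x, 2 * heatFlow t φ x ≤ ENNReal.ofReal (heatLevel N A t)

theorem HasHeatBound.mono {φ ψ : E N → ℝ≥0∞} {A : ℝ} (hψ : HasHeatBound ψ A)
    (h : ∀ᵐ y, φ y ≤ ψ y) : HasHeatBound φ A :=
  Eventually.mono hψ fun _ ht x => (mul_le_mul_right (heatFlow_mono h x) 2).trans (ht x)

theorem hasHeatBound_add_const (hN : N ≠ 0) {ψ : E N → ℝ≥0∞} (hψ : AEMeasurable ψ) {b : ℝ≥0∞}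
    (hb : b ≠ ⊤) {A : ℝ} (hA : 2 * smoothingConst N * ulMass ψ < ENNReal.ofReal A) :
    HasHeatBound (fun y => ψ y + b) A := by
  set a := (2 * smoothingConst N * ulMass ψ).toReal
  have ha : ENNReal.ofReal a = 2 * smoothingConst N * ulMass ψ :=
    ENNReal.ofReal_toReal (ne_top_of_lt hA)
  have haA : 0 < A - a := sub_pos.2 ((ENNReal.lt_ofReal_iff_toReal_lt (ne_top_of_lt hA)).1 hA)
  filter_upwards [(tendsto_heatLevel hN haA).eventually_ge_atTop (2 * b).toReal,
    Ioc_mem_nhdsGT zero_lt_one] with t h_level ht x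
  have h_power : 0 ≤ t ^ (-((N : ℝ) / 2)) := Real.rpow_nonneg ht.1.le _
  calc 2 * heatFlow t (fun y => ψ y + b) x
      ≤ 2 * (ENNReal.ofReal (t ^ (-((N : ℝ) / 2))) * (smoothingConst N * ulMass ψ) + b) := by
        rw [heatFlow_add _ hψ, heatFlow_const ht.1]
        gcongr
        exact heatFlow_le_rpow_mul_ulMass hψ ht.1 ht.2 x
    _ = ENNReal.ofReal (heatLevel N a t) + 2 * b := by
        rw [heatLevel, ENNReal.ofReal_mul ENNReal.toReal_nonneg, ha]
        ring
    _ ≤ ENNReal.ofReal (heatLevel N a t) + ENNReal.ofReal (heatLevel N (A - a) t) := by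
        gcongr
        exact ENNReal.le_ofReal_iff_toReal_le (ENNReal.mul_ne_top ENNReal.ofNat_ne_top hb)
          (ENNReal.toReal_nonneg.trans h_level) |>.2 h_level
    _ = ENNReal.ofReal (heatLevel N A t) := by
        unfold heatLevel
        rw [← ENNReal.ofReal_add (mul_nonneg ENNReal.toReal_nonneg h_power)
          (mul_nonneg haA.le h_power), ← add_mul, add_sub_cancel]

theorem MemLul.exists_hasHeatBound (hN : N ≠ 0) {g : E N → ℝ} (hg : MemLul g) {b : ℝ≥0∞}
    (hb : b ≠ ⊤) : ∃ A > 0, HasHeatBound (fun y => ‖g y‖ₑ + b) A := by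
  have h_fin : 2 * smoothingConst N * ulMass (fun y => ‖g y‖ₑ) ≠ ⊤ :=
    ENNReal.mul_ne_top (ENNReal.mul_ne_top ENNReal.ofNat_ne_top (smoothingConst_ne_top N)) hg.2.ne
  refine ⟨(2 * smoothingConst N * ulMass (fun y => ‖g y‖ₑ)).toReal + 1, by positivity, ?_⟩
  refine hasHeatBound_add_const hN hg.1.aestronglyMeasurable.enorm hb ?_
  rw [ENNReal.lt_ofReal_iff_toReal_lt h_fin]
  exact lt_add_one _

theorem IsBUC.exists_enorm_le {g : E N → ℝ} (hg : IsBUC g) :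
    ∃ B : ℝ≥0∞, B ≠ ⊤ ∧ ∀ x, ‖g x‖ₑ ≤ B := by
  obtain ⟨B, hB⟩ := hg.2
  refine ⟨ENNReal.ofReal B, ENNReal.ofReal_ne_top, fun x => ?_⟩
  rw [Real.enorm_eq_ofReal_abs]
  exact ENNReal.ofReal_le_ofReal (hB x)

theorem MemLulClosure.hasHeatBound (hN : N ≠ 0) {g : E N → ℝ} (hg : MemLulClosure g) {b : ℝ≥0∞}
    (hb : b ≠ ⊤) {A : ℝ} (hA : 0 < A) : HasHeatBound (fun y => ‖g y‖ₑ + b) A := by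
  have h_const : 2 * smoothingConst N ≠ ⊤ :=
    ENNReal.mul_ne_top ENNReal.ofNat_ne_top (smoothingConst_ne_top N)
  obtain ⟨h, hh, h_near⟩ := hg.2 (ENNReal.ofReal A / (2 * smoothingConst N))
    (ENNReal.div_pos (ENNReal.ofReal_pos.2 hA).ne' h_const)
  obtain ⟨B, hB_top, hB⟩ := hh.exists_enorm_le
  have h_meas : AEMeasurable (fun y => ‖g y - h y‖ₑ) :=
    (hg.1.1.aestronglyMeasurable.sub hh.1.continuous.aestronglyMeasurable).enorm
  refine (hasHeatBound_add_const hN h_meas (ENNReal.add_ne_top.2 ⟨hB_top, hb⟩) ?_).mono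
    (ae_of_all _ fun y => ?_)
  · exact mul_comm (2 * smoothingConst N) _ ▸ ENNReal.mul_lt_of_lt_div h_near
  · calc ‖g y‖ₑ + b = ‖(g y - h y) + h y‖ₑ + b := by rw [sub_add_cancel]
      _ ≤ ‖g y - h y‖ₑ + (B + b) := by
        rw [← add_assoc]
        gcongr
        exact (enorm_add_le _ _).trans (add_le_add_right (hB y) _)

theorem tendsto_sourceConst {γ : ℝ} (hγ0 : 0 ≤ γ) (hγ : γ < min 2 (N : ℝ)) :
    Tendsto (sourceConst N γ) (𝓝[>] 0) (𝓝 0) := by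
  have hγN := hγ.trans_le (min_le_right _ _)
  have h_exponent : 0 < (2 - γ) / (N : ℝ) :=
    div_pos (sub_pos.2 (hγ.trans_le (min_le_left _ _))) (hγ0.trans_lt hγN)
  have h_rpow : Tendsto (fun A : ℝ => 2 / N * A ^ ((2 - γ) / (N : ℝ))) (𝓝[>] 0) (𝓝 0) := by
    have h_cont := (Real.continuousAt_rpow_const 0 _ (Or.inr h_exponent.le)).tendsto
    rw [Real.zero_rpow h_exponent.ne'] at h_cont
    simpa only [mul_zero] using (h_cont.mono_left nhdsWithin_le_nhds).const_mul (2 / (N : ℝ))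
  have h_const : 2 * hardyConst N γ ≠ ⊤ :=
    ENNReal.mul_ne_top ENNReal.ofNat_ne_top (hardyConst_ne_top hγ0 hγN)
  have h_lim := ENNReal.Tendsto.const_mul (ENNReal.tendsto_ofReal h_rpow) (Or.inr h_const)
  rwa [ENNReal.ofReal_zero, mul_zero] at h_lim

theorem exists_hasHeatBound_and_eventually_le_one {γ : ℝ} (hγ0 : 0 ≤ γ) (hγ : γ < min 2 (N : ℝ))
    {g : E N → ℝ} {b : ℝ≥0∞} (hb : b ≠ ⊤) {q : ℝ → ℝ≥0∞}
    (h : (MemLul g ∧ Tendsto q atTop (𝓝 0)) ∨ (MemLulClosure g ∧ limsup q atTop < ⊤)) :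
    ∃ A > 0, HasHeatBound (fun y => ‖g y‖ₑ + b) A ∧
      ∀ᶠ η in atTop, sourceConst N γ A * q η ≤ 1 := by
  have hγN := hγ.trans_le (min_le_right _ _)
  have hN : N ≠ 0 := Nat.cast_ne_zero.1 (hγ0.trans_lt hγN).ne'
  rcases h with ⟨hg, hq⟩ | ⟨hg, hq⟩
  · obtain ⟨A, hA, h_bound⟩ := hg.exists_hasHeatBound hN hb
    have h_const : sourceConst N γ A ≠ ⊤ := ENNReal.mul_ne_top
      (ENNReal.mul_ne_top ENNReal.ofNat_ne_top (hardyConst_ne_top hγ0 hγN)) ENNReal.ofReal_ne_top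
    have h_lim := ENNReal.Tendsto.const_mul hq (Or.inr h_const)
    rw [mul_zero] at h_lim
    exact ⟨A, hA, h_bound, h_lim.eventually_le_const zero_lt_one⟩
  · obtain ⟨m, hqm, hm⟩ := exists_between hq
    have h_lim := ENNReal.Tendsto.mul_const (tendsto_sourceConst hγ0 hγ) (Or.inr hm.ne)
    rw [zero_mul] at h_lim
    obtain ⟨A, h_small, hA⟩ :=
      ((h_lim.eventually_le_const zero_lt_one).and self_mem_nhdsWithin).exists
    refine ⟨A, hA, hg.hasHeatBound hN hb hA, ?_⟩
    filter_upwards [eventually_lt_of_limsup_lt hqm] with η hη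
    exact (mul_le_mul_right hη.le _).trans h_small

theorem GrowthFunction.exists_hasHeatBound_and_quantity_le {H : ℝ → ℝ} (hH : GrowthFunction H)
    {R : ℝ} (hR0 : 0 < R) (hR : MonotoneOn (D H) (Ici R)) {γ : ℝ} (hγ0 : 0 ≤ γ)
    (hγ : γ < min 2 (N : ℝ)) {f : ℝ → ℝ} (hf : MonotoneOn f (Ici R)) {θ : ℝ} (hθ0 : 0 ≤ θ)
    (hθ1 : θ ≤ 1) {ζ : ℝ} {g : E N → ℝ} {b : ℝ≥0∞} (hb : b ≠ ⊤)
    (h : (MemLul g ∧ Tendsto (fun η => quantity N γ f H θ ζ η) atTop (𝓝 0)) ∨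
      (MemLulClosure g ∧ limsup (fun η => quantity N γ f H θ ζ η) atTop < ⊤)) :
    ∃ A > 0, HasHeatBound (fun y => ‖g y‖ₑ + b) A ∧
      ∀ᶠ η in atTop, sourceConst N γ A * quantity N γ f H θ R η ≤ 1 := by
  set κ := ENNReal.ofReal (H (max R ζ) / H R) ^ 2
  have hκ : κ ≠ ⊤ := ENNReal.pow_ne_top ENNReal.ofReal_ne_top
  have h_scaled : (MemLul g ∧ Tendsto (fun η => κ * quantity N γ f H θ ζ η) atTop (𝓝 0)) ∨
      (MemLulClosure g ∧ limsup (fun η => κ * quantity N γ f H θ ζ η) atTop < ⊤) := by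
    refine h.imp (And.imp_right fun hQ => ?_) (And.imp_right fun hQ => ?_)
    · simpa only [mul_zero] using ENNReal.Tendsto.const_mul hQ (Or.inr hκ)
    · rw [ENNReal.limsup_const_mul_of_ne_top hκ]
      exact ENNReal.mul_lt_top hκ.lt_top hQ
  obtain ⟨A, hA, h_bound, h_le⟩ := exists_hasHeatBound_and_eventually_le_one hγ0 hγ hb h_scaled
  refine ⟨A, hA, h_bound, ?_⟩
  filter_upwards [h_le, eventually_ge_atTop (max R ζ)] with η hη hRη
  exact (mul_le_mul_right (hH.quantity_le_const_mul hR0 hR γ hf hθ0 hθ1 hRη) _).trans hη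

theorem memLul_of_ulNorm_lt_top {φ : E N → ℝ} (hφ : AEStronglyMeasurable φ)
    (h : ulNorm φ < ⊤) : MemLul φ := by
  refine ⟨fun x => ⟨Metric.ball x 1, Metric.ball_mem_nhds x one_pos, hφ.restrict, ?_⟩, h⟩
  exact (le_iSup (fun y => ∫⁻ x in Metric.ball y 1, ‖φ x‖ₑ) x).trans_lt h

theorem isSolution_toReal {γ : ℝ} {f : ℝ → ℝ} (hf : MonotoneOn f (Ici 0)) {u₀ : E N → ℝ} {T : ℝ}
    {U : E N → ℝ → ℝ≥0∞} (hU : Measurable fun p : E N × ℝ => U p.1 p.2)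
    (hU_eq : ∀ t ∈ Ioo 0 T, ∀ x, U x t =
      duhamel (hardyWeight γ) (extendNonneg f) (fun y => ENNReal.ofReal (u₀ y)) U x t)
    {b : ℝ → ℝ≥0} (hb : AntitoneOn b (Ioo 0 T)) (hUb : ∀ t ∈ Ioo 0 T, ∀ x, U x t ≤ b t)
    {M : ℝ≥0} (hUM : ∀ t ∈ Ioo 0 T, ulMass (fun x => U x t) ≤ M) :
    IsSolution γ f u₀ T fun x t => (U x t).toReal := by
  have hU_top {t : ℝ} (ht : t ∈ Ioo 0 T) (x : E N) : U x t ≠ ⊤ :=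
    ne_top_of_le_ne_top ENNReal.coe_ne_top (hUb t ht x)
  have h_enorm {t : ℝ} (ht : t ∈ Ioo 0 T) (x : E N) : ‖(U x t).toReal‖ₑ = U x t := by
    rw [Real.enorm_eq_ofReal ENNReal.toReal_nonneg, ENNReal.ofReal_toReal (hU_top ht x)]
  refine ⟨?_, fun _ _ _ => ENNReal.toReal_nonneg, ⟨M, ?_⟩, fun a c ha hc => ⟨b a, ?_⟩, ?_⟩
  · exact (hU.comp (f := fun q : E N × Ioo (0 : ℝ) T => (q.1, (q.2 : ℝ)))
      (by fun_prop)).ennreal_toReal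
  · refine ae_restrict_of_forall_mem measurableSet_Ioo fun t ht => ?_
    have h_meas : Measurable fun x => (U x t).toReal :=
      (hU.comp (f := fun x : E N => (x, t)) (by fun_prop)).ennreal_toReal
    have h_le : ulNorm (fun x => (U x t).toReal) ≤ M := by
      simpa only [ulNorm, ulMass, h_enorm ht] using hUM t ht
    exact ⟨memLul_of_ulNorm_lt_top h_meas.aestronglyMeasurable
      (h_le.trans_lt ENNReal.coe_lt_top), h_le⟩
  · refine ae_restrict_of_forall_mem measurableSet_Icc fun t ht => ?_
    have ht_mem : t ∈ Ioo 0 T := ⟨ha.trans_le ht.1, ht.2.trans_lt hc⟩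
    have ha_mem : a ∈ Ioo 0 T := ⟨ha, ht.1.trans_lt ht_mem.2⟩
    rw [eLpNorm_exponent_top]
    refine eLpNormEssSup_le_of_ae_enorm_bound (ae_of_all _ fun x => ?_)
    rw [h_enorm ht_mem]
    exact (hUb t ht_mem x).trans (ENNReal.coe_le_coe.2 (hb ha_mem ht_mem ht.1))
  · refine fun t ht => ae_of_all _ fun x => ?_
    rw [ENNReal.ofReal_toReal (hU_top ht x), hU_eq t ht x]
    refine congrArg (_ + ·) (setLIntegral_congr_fun measurableSet_Ioo fun s hs => ?_)
    have h_source (y : E N) : hardyWeight γ y * extendNonneg f (U y s) =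
        ENNReal.ofReal (‖y‖ ^ (-γ) * f (U y s).toReal) := by
      rw [extendNonneg_of_ne_top hf (hU_top ⟨hs.1, hs.2.trans ht.2⟩ y), hardyWeight,
        ENNReal.ofReal_mul (Real.rpow_nonneg (norm_nonneg y) _)]
    simp only [h_source]

theorem IsSolution.congr_init {γ : ℝ} {f : ℝ → ℝ} {u₀ v₀ : E N → ℝ} {T : ℝ} {u : E N → ℝ → ℝ}
    (h : IsSolution γ f v₀ T u) (huv : u₀ =ᵐ[volume] v₀) : IsSolution γ f u₀ T u where
  measurable := h.measurable
  nonneg := h.nonneg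
  bounded_ul := h.bounded_ul
  locally_bounded := h.locally_bounded
  mild t ht := by
    filter_upwards [h.mild t ht] with x hx
    rw [hx]
    exact congrArg (· + _) (heatFlow_congr (huv.fun_comp ENNReal.ofReal).symm x)

namespace GrowthFunction

variable {H : ℝ → ℝ} {R : ℝ}

theorem tendsto_inverseAbove (hH : GrowthFunction H) (hR : 0 ≤ R) :
    Tendsto (inverseAbove H R) atTop atTop := by
  refine tendsto_atTop.2 fun y => ?_
  have hy : R ≤ max y R := le_max_right y R
  filter_upwards [eventually_gt_atTop (H (max y R))] with z hz
  have hz' : H R ≤ z := (hH.monotoneOn_Ici hR self_mem_Ici hy hy).trans hz.le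
  refine (le_max_left y R).trans (le_of_not_ge fun h => hz.not_ge ?_)
  exact (hH.inverseAbove_le_iff hR hz' (hR.trans hy)).1 h

theorem ofReal_barrier_le (hH : GrowthFunction H) (hR0 : 0 < R) (hR : MonotoneOn (D H) (Ici R))
    {φ : E N → ℝ≥0∞} {t : ℝ} {x : E N} (h_lo : ENNReal.ofReal (H R) ≤ heatFlow t φ x)
    (h_fin : 2 * heatFlow t φ x ≠ ⊤) :
    ENNReal.ofReal (barrier H R φ x t) ≤
      ENNReal.ofReal (D H R)⁻¹ * (2 * heatFlow t φ x) + ENNReal.ofReal R := by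
  have hD := hH.deriv_pos R hR0
  have hp := hH.le_barrier hR0.le h_lo h_fin
  have h_tangent := hH.add_deriv_mul_le hR0 hR le_rfl hp
  rw [← hH.ofReal_apply_barrier hR0.le h_lo h_fin, ← ENNReal.ofReal_mul (inv_pos.2 hD).le,
    ← ENNReal.ofReal_add (mul_nonneg (inv_pos.2 hD).le (hH.nonneg (hR0.le.trans hp))) hR0.le]
  refine ENNReal.ofReal_le_ofReal ?_
  rw [← sub_le_iff_le_add, le_inv_mul_iff₀ hD]
  linarith [hH.pos R hR0]

variable {φ : E N → ℝ≥0∞} {A T : ℝ}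

theorem minimalSolution_le_barrier (hH : GrowthFunction H) (hR0 : 0 < R)
    (hR : MonotoneOn (D H) (Ici R)) {γ : ℝ} (hγ0 : 0 ≤ γ) (hγN : γ < N) {f : ℝ → ℝ}
    (hf : MonotoneOn f (Ici 0)) {θ : ℝ} (hθ0 : 0 ≤ θ) (hθ1 : θ ≤ 1) (hA : 0 < A)
    {u₀ : E N → ℝ} (hu₀ : Measurable u₀) (hφ : φ = fun y => ENNReal.ofReal (H (max (u₀ y) R)))
    (hφ_hi : ∀ t ∈ Ioo 0 T, ∀ x, 2 * heatFlow t φ x ≤ ENNReal.ofReal (heatLevel N A t))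
    (h_quantity : ∀ t ∈ Ioo 0 T, sourceConst N γ A *
      quantity N γ f H θ R (inverseAbove H R (heatLevel N A t)) ≤ 1) {t : ℝ} (ht : t ∈ Ioo 0 T)
    (x : E N) :
    minimalSolution (hardyWeight γ) (extendNonneg f) (fun y => ENNReal.ofReal (u₀ y)) x t ≤
      ENNReal.ofReal (barrier H R φ x t) := by
  refine minimalSolution_le_of_duhamel_le (monotone_extendNonneg hf)
    (V := fun x t => ENNReal.ofReal (barrier H R φ x t)) (fun t ht x => ?_) ht x
  have h_init : heatFlow t (fun y => ENNReal.ofReal (u₀ y)) x ≤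
      heatFlow t (fun y => ENNReal.ofReal (max (u₀ y) R)) x :=
    heatFlow_mono (ae_of_all _ fun y => ENNReal.ofReal_le_ofReal (le_max_left _ _)) x
  exact (add_le_add_left h_init _).trans <|
    hH.duhamel_barrier_le hR0 hR hγ0 hγN hf hθ0 hθ1 hA ht.1 (hu₀.max measurable_const)
      (fun y => le_max_right _ _) hφ (fun s hs => hφ_hi s ⟨hs.1, hs.2.trans_lt ht.2⟩)
      (h_quantity t ht) x

theorem isSolution_toReal_of_le_barrier (hH : GrowthFunction H) (hR0 : 0 < R)
    (hR : MonotoneOn (D H) (Ici R)) {γ : ℝ} {f : ℝ → ℝ} (hf : MonotoneOn f (Ici 0)) (hA : 0 < A)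
    (hφ : Measurable φ) (hφ_lo : ∀ y, ENNReal.ofReal (H R) ≤ φ y) (hφ_ul : ulMass φ ≠ ⊤)
    (hφ_hi : ∀ t ∈ Ioo 0 T, ∀ x, 2 * heatFlow t φ x ≤ ENNReal.ofReal (heatLevel N A t))
    {u₀ : E N → ℝ} {U : E N → ℝ → ℝ≥0∞} (hU : Measurable fun p : E N × ℝ => U p.1 p.2)
    (hU_eq : ∀ t ∈ Ioo 0 T, ∀ x, U x t =
      duhamel (hardyWeight γ) (extendNonneg f) (fun y => ENNReal.ofReal (u₀ y)) U x t)
    (hU_le : ∀ t ∈ Ioo 0 T, ∀ x, U x t ≤ ENNReal.ofReal (barrier H R φ x t)) :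
    IsSolution γ f u₀ T fun x t => (U x t).toReal := by
  set c := ENNReal.ofReal (D H R)⁻¹
  have h_linear (t : ℝ) (ht : t ∈ Ioo 0 T) (x : E N) :
      U x t ≤ c * (2 * heatFlow t φ x) + ENNReal.ofReal R :=
    (hU_le t ht x).trans <| hH.ofReal_barrier_le hR0 hR (le_heatFlow_of_le ht.1 hφ_lo x) <|
      ne_top_of_le_ne_top ENNReal.ofReal_ne_top (hφ_hi t ht x)
  set M := c * (2 * ulMass φ) + ENNReal.ofReal R * volume (Metric.ball (0 : E N) 1)
  have hM : M ≠ ⊤ := ENNReal.add_ne_top.2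
    ⟨ENNReal.mul_ne_top ENNReal.ofReal_ne_top (ENNReal.mul_ne_top ENNReal.ofNat_ne_top hφ_ul),
      ENNReal.mul_ne_top ENNReal.ofReal_ne_top measure_ball_lt_top.ne⟩
  refine isSolution_toReal hf hU hU_eq (M := M.toNNReal)
    (b := fun t => (D H R)⁻¹.toNNReal * (heatLevel N A t).toNNReal + R.toNNReal)
    (fun s hs t _ hst => ?_) (fun t ht x => ?_) fun t ht => ?_
  · have h_level : heatLevel N A t ≤ heatLevel N A s := mul_le_mul_of_nonneg_left
      (Real.rpow_le_rpow_of_nonpos hs.1 hst (neg_nonpos.2 (by positivity))) hA.le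
    dsimp only
    gcongr
  · push_cast
    exact (h_linear t ht x).trans (add_le_add_left (mul_le_mul_right (hφ_hi t ht x) _) _)
  · rw [ENNReal.coe_toNNReal hM]
    calc ulMass (fun x => U x t)
        ≤ ulMass (fun x => c * (2 * heatFlow t φ x) + ENNReal.ofReal R) :=
          ulMass_mono (ae_of_all _ (h_linear t ht))
      _ ≤ c * (2 * ulMass (heatFlow t φ)) +
            ENNReal.ofReal R * volume (Metric.ball (0 : E N) 1) := by
          refine (ulMass_add_const_le _ _).trans_eq ?_
          rw [ulMass_const_mul ENNReal.ofReal_ne_top, ulMass_const_mul ENNReal.ofNat_ne_top]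
      _ ≤ M := add_le_add_left
          (mul_le_mul_right (mul_le_mul_right (ulMass_heatFlow_le hφ ht.1) _) _) _

theorem memLul_comp_of_le_barrier (hH : GrowthFunction H) (hR : 0 ≤ R) {t : ℝ} (ht : 0 < t)
    (hφ : Measurable φ) (hφ_lo : ∀ y, ENNReal.ofReal (H R) ≤ φ y) (hφ_ul : ulMass φ ≠ ⊤)
    (hφ_fin : ∀ x, 2 * heatFlow t φ x ≠ ⊤) {v : E N → ℝ} (hv : Measurable v)
    (hv0 : ∀ x, 0 ≤ v x) (hv_le : ∀ x, v x ≤ barrier H R φ x t) :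
    MemLul (fun x => H (v x)) ∧ ulNorm (fun x => H (v x)) ≤ 2 * ulMass φ := by
  have h_pointwise (x : E N) : ‖H (v x)‖ₑ ≤ 2 * heatFlow t φ x := by
    rw [Real.enorm_eq_ofReal (hH.nonneg (hv0 x)),
      ← hH.ofReal_apply_barrier hR (le_heatFlow_of_le ht hφ_lo x) (hφ_fin x)]
    exact ENNReal.ofReal_le_ofReal
      (hH.strictMonoOn.monotoneOn (hv0 x) ((hv0 x).trans (hv_le x)) (hv_le x))
  have h_le : ulNorm (fun x => H (v x)) ≤ 2 * ulMass φ := by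
    calc ulNorm (fun x => H (v x)) ≤ ulMass fun x => 2 * heatFlow t φ x :=
          ulMass_mono (ae_of_all _ h_pointwise)
      _ ≤ 2 * ulMass φ := by
          rw [ulMass_const_mul ENNReal.ofNat_ne_top]
          gcongr
          exact ulMass_heatFlow_le hφ ht
  exact ⟨memLul_of_ulNorm_lt_top (hH.measurable_comp hv hv0).aestronglyMeasurable
    (h_le.trans_lt (ENNReal.mul_lt_top ENNReal.ofNat_lt_top hφ_ul.lt_top)), h_le⟩

theorem exists_isSolution (hH : GrowthFunction H) (hR0 : 0 < R) (hR : MonotoneOn (D H) (Ici R))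
    {γ : ℝ} (hγ0 : 0 ≤ γ) (hγN : γ < N) {f : ℝ → ℝ} (hf_cont : ContinuousOn f (Ici 0))
    (hf : MonotoneOn f (Ici 0)) {θ : ℝ} (hθ0 : 0 ≤ θ) (hθ1 : θ ≤ 1) (hA : 0 < A)
    {u₀ : E N → ℝ} (hu₀ : Measurable u₀) (hφ : φ = fun y => ENNReal.ofReal (H (max (u₀ y) R)))
    (hφ_ul : ulMass φ ≠ ⊤) (h_bound : HasHeatBound φ A)
    (h_quantity : ∀ᶠ η in atTop, sourceConst N γ A * quantity N γ f H θ R η ≤ 1) :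
    ∃ T > 0, ∃ u : E N → ℝ → ℝ, IsSolution γ f u₀ T u ∧
      ∀ t ∈ Ioo 0 T, MemLul (fun x => H (u x t)) ∧
        ulNorm (fun x => H (u x t)) ≤ 2 * ulMass φ := by
  have hN : N ≠ 0 := Nat.cast_ne_zero.1 (hγ0.trans_lt hγN).ne'
  have hwR (y : E N) : R ≤ max (u₀ y) R := le_max_right _ _
  have hφ_meas : Measurable φ := hφ ▸ (hH.measurable_comp (hu₀.max measurable_const)
    fun y => hR0.le.trans (hwR y)).ennreal_ofReal
  have hφ_lo (y : E N) : ENNReal.ofReal (H R) ≤ φ y := by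
    rw [hφ]
    exact ENNReal.ofReal_le_ofReal (hH.monotoneOn_Ici hR0.le self_mem_Ici (hwR y) (hwR y))
  have h_level : Tendsto (fun t => inverseAbove H R (heatLevel N A t)) (𝓝[>] 0) atTop :=
    (hH.tendsto_inverseAbove hR0.le).comp (tendsto_heatLevel hN hA)
  obtain ⟨T, hT0, hT⟩ := mem_nhdsGT_iff_exists_Ioo_subset.1
    (Eventually.and h_bound (h_level.eventually h_quantity))
  set w₀ := fun y => ENNReal.ofReal (u₀ y)
  have hf_mono := monotone_extendNonneg hf
  have hf_lsc := lowerSemicontinuous_extendNonneg hf_cont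
  set U := minimalSolution (hardyWeight γ) (extendNonneg f) w₀
  have hU : Measurable fun p : E N × ℝ => U p.1 p.2 :=
    measurable_minimalSolution (measurable_hardyWeight γ) hf_lsc.measurable hu₀.ennreal_ofReal
  have hU_le {t : ℝ} (ht : t ∈ Ioo 0 T) (x : E N) :
      U x t ≤ ENNReal.ofReal (barrier H R φ x t) :=
    hH.minimalSolution_le_barrier hR0 hR hγ0 hγN hf hθ0 hθ1 hA hu₀ hφ (fun t ht => (hT ht).1)
      (fun t ht => (hT ht).2) ht x
  refine ⟨T, hT0, fun x t => (U x t).toReal, ?_, fun t ht => ?_⟩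
  · exact hH.isSolution_toReal_of_le_barrier hR0 hR hf hA hφ_meas hφ_lo hφ_ul
      (fun t ht => (hT ht).1) hU (fun t _ x => minimalSolution_eq_duhamel
        (measurable_hardyWeight γ) hf_mono hf_lsc hu₀.ennreal_ofReal x t) fun t ht => hU_le ht
  · have h_fin (x : E N) : 2 * heatFlow t φ x ≠ ⊤ :=
      ne_top_of_le_ne_top ENNReal.ofReal_ne_top ((hT ht).1 x)
    refine hH.memLul_comp_of_le_barrier hR0.le ht.1 hφ_meas hφ_lo hφ_ul h_fin
      (hU.comp (f := fun x : E N => (x, t)) (by fun_prop)).ennreal_toReal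
      (fun x => ENNReal.toReal_nonneg) fun x => ENNReal.toReal_le_of_le_ofReal ?_ (hU_le ht x)
    exact hR0.le.trans (hH.le_barrier hR0.le (le_heatFlow_of_le ht.1 hφ_lo x) (h_fin x))

end GrowthFunction

theorem monotoneOn_Ici_of_continuousOn {f : ℝ → ℝ} {a : ℝ} (hf_cont : ContinuousOn f (Ici a))
    (hf : MonotoneOn f (Ioi a)) : MonotoneOn f (Ici a) := by
  rw [← Ioi_insert]
  refine hf.insert_of_continuousWithinAt (mem_closure_iff_clusterPt.1 ?_)
    ((hf_cont a self_mem_Ici).mono Ioi_subset_Ici_self)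
  exact closure_Ioi a ▸ self_mem_Ici

theorem GrowthFunction.ofReal_comp_max_le {H : ℝ → ℝ} (hH : GrowthFunction H) {R : ℝ} (hR : 0 ≤ R)
    {u v : E N → ℝ} (hu : ∀ᵐ x, 0 ≤ u x) (huv : u =ᵐ[volume] v) :
    ∀ᵐ x, ENNReal.ofReal (H (max (v x) R)) ≤ ‖H (u x)‖ₑ + ENNReal.ofReal (H R) := by
  filter_upwards [hu, huv] with x hx hux
  rw [← hux, Real.enorm_eq_ofReal (hH.nonneg hx),
    ← ENNReal.ofReal_add (hH.nonneg hx) (hH.nonneg hR)]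
  exact ENNReal.ofReal_le_ofReal (hH.apply_max_le_add hx hR)

end HardyParabolic

end

open HardyParabolic in
theorem mainTheorem3_general (N : ℕ) (H : ℝ → ℝ) (hH : GrowthFunction H)
    (u₀ : E N → ℝ) (hu₀_meas : AEMeasurable u₀ volume)
    (hu₀ : ∀ᵐ x, 0 ≤ u₀ x) :
    ∃ C : ℝ, 0 < C ∧
      ∀ γ : ℝ, 0 ≤ γ → γ < min 2 (N : ℝ) →
      ∀ f : ℝ → ℝ, ContinuousOn f (Ici 0) → (∀ ξ, 0 < ξ → 0 ≤ f ξ) → MonotoneOn f (Ioi 0) →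
      ∀ θ : ℝ, 0 ≤ θ → θ ≤ 1 → ∀ ζ : ℝ, 0 ≤ ζ →
        ((MemLul (fun x => H (u₀ x)) ∧
            Tendsto (fun η : ℝ => quantity N γ f H θ ζ η) atTop (𝓝 0)) ∨
          (MemLulClosure (fun x => H (u₀ x)) ∧
            limsup (fun η : ℝ => quantity N γ f H θ ζ η) atTop < ⊤)) →
        ∃ T : ℝ, 0 < T ∧ ∃ u : E N → ℝ → ℝ,
          IsSolution γ f u₀ T u ∧
          ∀ t ∈ Ioo (0 : ℝ) T,
            MemLul (fun x => H (u x t)) ∧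
            ulNorm (fun x => H (u x t)) ≤ ENNReal.ofReal C := by
  obtain ⟨R, hR0, hR⟩ := hH.deriv_mono
  set v₀ := hu₀_meas.mk u₀
  set φ : E N → ℝ≥0∞ := fun y => ENNReal.ofReal (H (max (v₀ y) R)) with hφ
  have hφ_le : ∀ᵐ y, φ y ≤ ‖H (u₀ y)‖ₑ + ENNReal.ofReal (H R) :=
    hH.ofReal_comp_max_le hR0.le hu₀ hu₀_meas.ae_eq_mk
  refine ⟨(2 * ulMass φ).toReal + 1, by positivity,
    fun γ hγ0 hγ f hf_cont _ hf θ hθ0 hθ1 ζ _ h => ?_⟩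
  have hf := monotoneOn_Ici_of_continuousOn hf_cont hf
  have hφ_ul : ulMass φ ≠ ⊤ := by
    have hu₀_ul : ulNorm (fun x => H (u₀ x)) ≠ ⊤ := (h.elim (·.1.2) (·.1.1.2)).ne
    refine ne_top_of_le_ne_top ?_ ((ulMass_mono hφ_le).trans (ulMass_add_const_le _ _))
    finiteness [hu₀_ul]
  obtain ⟨A, hA, h_bound, h_quantity⟩ := hH.exists_hasHeatBound_and_quantity_le hR0 hR hγ0 hγ
    (hf.mono (Ici_subset_Ici.2 hR0.le)) hθ0 hθ1 ENNReal.ofReal_ne_top h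
  obtain ⟨T, hT, u, hu, hu_le⟩ := hH.exists_isSolution hR0 hR hγ0 (hγ.trans_le (min_le_right _ _))
    hf_cont hf hθ0 hθ1 hA hu₀_meas.measurable_mk hφ hφ_ul (h_bound.mono hφ_le) h_quantity
  refine ⟨T, hT, u, hu.congr_init hu₀_meas.ae_eq_mk, fun t ht =>
    ⟨(hu_le t ht).1, (hu_le t ht).2.trans ((ENNReal.le_ofReal_iff_toReal_le ?_ ?_).2 ?_)⟩⟩
  · exact ENNReal.mul_ne_top ENNReal.ofNat_ne_top hφ_ul
  · positivity
  · exact (lt_add_one _).le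

theorem mainTheorem3 (N : ℕ) (hN : 1 ≤ N)
    (H : ℝ → ℝ) (hH : HardyParabolic.CondH H)
    (u₀ : HardyParabolic.E N → ℝ) (hu₀_meas : AEMeasurable u₀ volume)
    (hu₀ : ∀ᵐ x, 0 ≤ u₀ x) :
    ∃ C : ℝ, 0 < C ∧
      ∀ γ : ℝ, 0 < γ → γ < min 2 (N : ℝ) →
      ∀ f : ℝ → ℝ, ContinuousOn f (Ici 0) → (∀ ξ, 0 < ξ → 0 ≤ f ξ) → MonotoneOn f (Ioi 0) →
      ∀ θ : ℝ, 0 < θ → θ ≤ 1 → ∀ ζ : ℝ, 0 ≤ ζ →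
        ((HardyParabolic.MemLul (fun x => H (u₀ x)) ∧
            Tendsto (fun η : ℝ => HardyParabolic.quantity N γ f H θ ζ η) atTop (𝓝 0)) ∨
          (HardyParabolic.MemLulClosure (fun x => H (u₀ x)) ∧
            limsup (fun η : ℝ => HardyParabolic.quantity N γ f H θ ζ η) atTop < ⊤)) →
        ∃ T : ℝ, 0 < T ∧ ∃ u : HardyParabolic.E N → ℝ → ℝ,
          HardyParabolic.IsSolution γ f u₀ T u ∧
          ∀ t ∈ Ioo (0 : ℝ) T,
            HardyParabolic.MemLul (fun x => H (u x t)) ∧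
            HardyParabolic.ulNorm (fun x => H (u x t)) ≤ ENNReal.ofReal C := by
  obtain ⟨C, hC, h⟩ := mainTheorem3_general N H hH.growthFunction u₀ hu₀_meas hu₀
  exact ⟨C, hC, fun γ hγ hγN f hf_cont hf0 hf θ hθ => h γ hγ.le hγN f hf_cont hf0 hf θ hθ.le⟩
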